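/- Let $M$ be a finite simplicial cell complex of dimension $4$, i.e. a finite regular CW complex (in a Hausdorff space) of dimension $4$ in which the boundary of every $k$-cell is isomorphic, as a poset of cells under inclusion, to the boundary of a $k$-simplex. Suppose that * $M$ is a pseudotriangulation of a closed $4$-manifold: the vertex figure of every vertex of $M$ is PL-homeomorphic to the boundary of the standard $4$-simplex (the standard PL $3$-sphere); * $M$ is contracted: it has exactly $5$ vertices; * $M$ is simple: any two vertices of $M$ lie in at most one common edge. Label the vertices of $M$ bijectively by $C=\{0,1,2,3,4\}$, and let $(\Gamma,\gamma)$ be the corresponding crystallization, i.e. the $5$-coloured dual graph of $M$: its vertices are the facets ($4$-cells) of $M$, it has one edge $(\{\sigma_1,\sigma_2\},\tau)$ for every pair of distinct facets $\sigma_1,\sigma_2$ and every $3$-cell $\tau$ contained in both, and the colour of this edge is the label of the unique vertex of $M$ not contained in $\tau$. For $\{i,j\}\subset C$ with $i\neq j$ let $\Gamma_{\{i,j\}}$ be the subgraph of $\Gamma$ with the same vertices as $\Gamma$ and all edges of colour $i$ or $j$, and let $g_{ij}$ be its number of connected components. Then there is an integer $m \ge 0$ such that $g_{ij}=m$ for every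 $2$-element set $\{i,j\}\subset C$, and the number $f_4(M)$ of $4$-cells of $M$ satisfies $f_4(M)=6m-4$. -/

import Mathlib

open Topology

noncomputable section

namespace CellCx

universe u

/-! ### The face poset of a CW complex -/

section FacePoset

variable {X : Type u} [TopologicalSpace X]

/-- The (nonempty) cells of a CW complex, of all dimensions. -/
structure Face (C : Set X) [CWComplex C] where
  /-- the dimension of the cell -/
  dim : ℕ
  /-- the index of the cell among the cells of this dimension -/
  idx : RelCWComplex.cell C dim

variable {C : Set X} [CWComplex C]

/-- The closed cell, as a subset of the space. -/
def Face.closed (α : Face C) : Set X := RelCWComplex.closedCell α.dim α.idx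

theorem Face.eq_or_dim_lt {α β : Face C} (h : α.closed ⊆ β.closed) : α = β ∨ α.dim < β.dim := by
  obtain ⟨n, i⟩ := α
  obtain ⟨m, j⟩ := β
  have hx : RelCWComplex.map n i 0 ∈ RelCWComplex.closedCell m j :=
    h (RelCWComplex.map_zero_mem_closedCell n i)
  rw [← RelCWComplex.cellFrontier_union_openCell_eq_closedCell] at hx
  have key : ∀ (k : ℕ) (l : RelCWComplex.cell C k),
      RelCWComplex.map n i 0 ∈ RelCWComplex.openCell k l →
        (⟨n, i⟩ : Σ n, RelCWComplex.cell C n) = ⟨k, l⟩ := by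
    intro k l hl
    by_contra hne
    exact (Set.disjoint_left.mp (RelCWComplex.disjoint_openCell_of_ne hne)
      (RelCWComplex.map_zero_mem_openCell n i)) hl
  rcases hx with hx | hx
  · right
    obtain ⟨I, hI⟩ := CWComplex.cellFrontier_subset_finite_openCell m j
    have hx' := hI hx
    simp only [Set.mem_iUnion] at hx'
    obtain ⟨k, hk, l, _, hl⟩ := hx'
    have := congrArg Sigma.fst (key k l hl)
    simp only at this
    show n < m
    omega
  · left
    have := key m j hx
    cases this
    rfl

/-- The face poset: cells ordered by inclusion of the closed cells. -/
instance : PartialOrder (Face C) where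
  le α β := α.closed ⊆ β.closed
  le_refl _ := Set.Subset.refl _
  le_trans _ _ _ h₁ h₂ := Set.Subset.trans h₁ h₂
  le_antisymm α β h₁ h₂ := by
    rcases Face.eq_or_dim_lt h₁ with h | h
    · exact h
    rcases Face.eq_or_dim_lt h₂ with h' | h'
    · exact h'.symm
    · omega

end FacePoset

section Complexes

variable {X : Type u} [TopologicalSpace X] (C : Set X) [CWComplex C]

/-- The vertices (`0`-cells). -/
abbrev Vertex : Type u := {v : Face C // v.dim = 0}

/-- The entry `f_i` of the `f`-vector: the number of `i`-cells. -/
def fNumber (i : ℕ) : ℕ := Nat.card {α : Face C // α.dim = i}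

/-- `C` (with its CW structure) is a finite simplicial cell complex of dimension `d`: it is a finite
regular CW complex whose maximal cell dimension is `d`, and the boundary of each `k`-cell is
isomorphic, as a poset, to the boundary of a `k`-simplex, i.e. to the poset of nonempty proper
subsets of a set with `k + 1` elements. -/
structure IsSimplicialCellComplex (d : ℕ) : Prop where
  finite : Finite (Face C)
  /-- regularity: every characteristic map is injective on the closed ball, hence (for a Hausdorff
  space) a homeomorphism of the closed ball onto the closed cell -/
  regular : ∀ (n : ℕ) (i : RelCWComplex.cell C n),
    Set.InjOn (RelCWComplex.map n i) (Metric.closedBall 0 1)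
  dim_le : ∀ α : Face C, α.dim ≤ d
  exists_dim_eq : ∃ α : Face C, α.dim = d
  boundary : ∀ α : Face C, Nonempty
    ({β : Face C // β < α} ≃o {s : Finset (Fin (α.dim + 1)) // s.Nonempty ∧ s ≠ Finset.univ})

/-- A `d`-dimensional complex is contracted if it has exactly `d + 1` vertices. -/
def IsContracted (d : ℕ) : Prop := Nat.card (Vertex C) = d + 1

/-- `k`-simple: any set of `k + 1` vertices is in at most one `k`-cell. -/
def IsKSimple (k : ℕ) : Prop :=
  ∀ s : Finset (Vertex C), s.card = k + 1 → ∀ α β : Face C, α.dim = k → β.dim = k →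
    (∀ v ∈ s, v.1 ≤ α) → (∀ v ∈ s, v.1 ≤ β) → α = β

/-- Simple means `1`-simple. -/
def IsSimple : Prop := IsKSimple C 1

end Complexes

/-! ### Piecewise linear topology and pseudotriangulations -/

section PL

/-- Two subsets `A`, `B` of real vector spaces are PL-homeomorphic if there is a homeomorphism
`f : A → B` and a finite geometric simplicial complex `K` triangulating `A` such that `f` is affine
on every simplex of `K`. -/
def PLHomeomorphic {E F : Type*} [AddCommGroup E] [Module ℝ E] [TopologicalSpace E]
    [AddCommGroup F] [Module ℝ F] [TopologicalSpace F] (A : Set E) (B : Set F) : Prop :=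
  ∃ (f : A ≃ₜ B) (K : Geometry.SimplicialComplex ℝ E),
    K.faces.Finite ∧ K.space = A ∧
      ∀ s ∈ K.faces, ∃ g : E →ᵃ[ℝ] F, ∀ x : A, (x : E) ∈ convexHull ℝ (s : Set E) →
        (f x : F) = g x

/-- The standard PL `(d - 1)`-sphere: the boundary of the standard `d`-simplex. -/
def stdPLSphere (d : ℕ) : Set (Fin (d + 1) → ℝ) :=
  {x | x ∈ stdSimplex ℝ (Fin (d + 1)) ∧ ∃ i, x i = 0}

/-- The geometric realization of the order complex of a (finite) poset `P`: the union, over all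
chains of `P`, of the simplices spanned by the corresponding standard basis vectors, that is, all
points given by barycentric coordinates whose support is a chain. -/
def orderComplexCarrier (P : Type*) [PartialOrder P] : Set (P → ℝ) :=
  {x | (∀ a, 0 ≤ x a) ∧ ∑ᶠ a, x a = 1 ∧ IsChain (· ≤ ·) (Function.support x)}

variable {X : Type u} [TopologicalSpace X] (C : Set X) [CWComplex C]

/-- The geometric carrier of the vertex figure of `v`. The cells of the vertex figure of `v` are the
intersections with the cells `α > v` of the boundary of a small neighbourhood of `v`, so its face
poset is `{α // v < α}`. It is a simplicial cell complex, and its carrier (with its PL structure) is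
realized by its barycentric subdivision, the order complex of the face poset. -/
def vertexFigureCarrier (v : Vertex C) : Set ({α : Face C // v.1 < α} → ℝ) :=
  orderComplexCarrier {α : Face C // v.1 < α}

/-- `C` is a pseudotriangulation of a closed `d`-manifold: a finite `d`-dimensional simplicial cell
complex all of whose vertex figures are PL-homeomorphic to the standard PL `(d - 1)`-sphere. -/
structure IsPseudotriangulation (d : ℕ) : Prop where
  isSimplicialCellComplex : IsSimplicialCellComplex C d
  vertexFigure : ∀ v : Vertex C, PLHomeomorphic (vertexFigureCarrier C v) (stdPLSphere d)

end PL

/-! ### The coloured dual graph -/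

section DualGraph

/-- The number of connected components of a multigraph: the number of classes of vertices under the
equivalence relation generated by adjacency. -/
def numComponents {α β : Type*} (G : Graph α β) : ℕ :=
  Nat.card (Quot fun x y : {z // z ∈ G.vertexSet} => G.Adj x.1 y.1)

variable {X : Type u} [TopologicalSpace X] (C : Set X) [CWComplex C]

/-- The dual graph of a `d`-dimensional complex: a multigraph without loops whose vertices are the
facets (`d`-cells) and whose edges are the pairs `({σ₁, σ₂}, γ)` where `σ₁ ≠ σ₂` are facets and `γ`
is a `(d - 1)`-cell that is a face of both. -/
def dualGraph (d : ℕ) : Graph (Face C) (Sym2 (Face C) × Face C) where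
  vertexSet := {σ | σ.dim = d}
  edgeSet := {e | ∃ x y : Face C, e.1 = s(x, y) ∧ x ≠ y ∧ x.dim = d ∧ y.dim = d ∧
    e.2.dim + 1 = d ∧ e.2 ≤ x ∧ e.2 ≤ y}
  IsLink e x y := e.1 = s(x, y) ∧ x ≠ y ∧ x.dim = d ∧ y.dim = d ∧
    e.2.dim + 1 = d ∧ e.2 ≤ x ∧ e.2 ≤ y
  isLink_symm := by
    intro e _
    constructor
    intro x y h
    exact ⟨h.1.trans Sym2.eq_swap, h.2.1.symm, h.2.2.2.1, h.2.2.1, h.2.2.2.2.1,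
      h.2.2.2.2.2.2, h.2.2.2.2.2.1⟩
  eq_or_eq_of_isLink_of_isLink := by
    intro e x y v w h₁ h₂
    have h := h₁.1.symm.trans h₂.1
    rw [Sym2.eq_iff] at h
    rcases h with h | h
    · exact Or.inl h.1
    · exact Or.inr h.1
  edge_mem_iff_exists_isLink := by
    intro e
    rfl
  left_mem_of_isLink := by
    intro e x y h
    exact h.2.2.1

variable {C}

/-- Let the `d + 1` vertices of a contracted `d`-dimensional complex be labelled by the colours
`0, …, d`. An edge `({σ₁, σ₂}, γ)` of the dual graph has colour `c` if the `(d - 1)`-cell `γ` is the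
one opposite to the vertex labelled `c`, i.e. does not contain that vertex. -/
def HasColor {d : ℕ} (lab : Fin (d + 1) ≃ Vertex C) (e : Sym2 (Face C) × Face C)
    (c : Fin (d + 1)) : Prop :=
  ¬ (lab c).1 ≤ e.2

/-- The subgraph `Γ_D` of the coloured dual graph `Γ` of a contracted `d`-dimensional complex: all
vertices of `Γ`, and those edges of `Γ` whose colour lies in `D`. -/
def colorSubgraph {d : ℕ} (lab : Fin (d + 1) ≃ Vertex C) (D : Set (Fin (d + 1))) :
    Graph (Face C) (Sym2 (Face C) × Face C) :=
  (dualGraph C d).restrict {e | ∃ c ∈ D, HasColor lab e c}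

end DualGraph

end CellCx

end

/-!
For a set `S` of three labels let `t S` be the number of `2`-cells whose vertices carry the labels
in `S`.

Since `M` is simple, there is just one edge on each pair of labels, and every cell with these two
vertices contains it. The link of an edge is a triangulated `2`-sphere, with `f₄` triangles (each
facet contains all five vertices, hence the edge), so with `2 + f₄ / 2` vertices. The vertices of
the link are the `2`-cells above the edge, so `t` has the sum `2 + f₄ / 2` over the three triples
containing a given pair of labels (`two_mul_sum_cellCount`). These ten linear equations force `t` to
be constant (`pairs_eq_of_sum_eq`), say `t = m`, and then `3 m = 2 + f₄ / 2`. Finally the components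
of `Γ_{ij}` correspond to the `2`-cells whose vertices have the other three labels
(`numComponents_colorSubgraph`).

The hypothesis on vertex figures enters in two ways, neither of which needs more topology than
convexity.

* The Euler relations: `∑ α ≥ ρ, (-1) ^ dim α = 1` for each cell `ρ` of positive dimension
  (`sum_neg_one_pow_dim`). For a set that is partitioned into finitely many relatively open
  polyhedral cells, the sum of `(-1) ^ dim` over the cells whose closure contains a point `x` does
  not depend on the partition (`localEuler_eq`): it is the value at a small neighbourhood of `x` of
  the Euler characteristic with compact supports, the valuation that is `(-1) ^ dim` on relatively
  open convex sets. Hence it is a PL invariant (`localEuler_eq_of_homeomorph`), equal to `-1` at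
  every point of a PL `3`-sphere. Evaluated in the order complex of the cells above a vertex, it is
  a signed count of chains, which `chainSum_mul_eq` turns into a signed count of cells.

* The facets around a `2`-cell `τ`: there is at least one, and any two are connected by a sequence
  of facets that share `3`-cells containing `τ` (`facets_above_triangle`). Near a point of the segment
  between an edge and `τ` in the barycentric subdivision of a vertex figure, the order complex minus
  the segment is the union of disjoint open pieces, one for each class of facets. On the other hand
  a PL `3`-sphere is locally an open subset of a three-dimensional space, in which the segment
  becomes a subset of finitely many lines, and these do not separate a ball
  (`exists_nhdsWithin_diff_line_isPreconnected`).
-/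

/-! ### The Euler characteristic as a valuation on relatively open convex sets -/

namespace PLEuler

section Valuation

variable {E : Type*} [NormedAddCommGroup E] [NormedSpace ℝ E]

/-- A relatively open convex set, given as the intersection of an open convex set with an affine
subspace. The empty set is allowed. -/
def IsRelOpenConvex (C : Set E) : Prop :=
  ∃ (U : Set E) (F : AffineSubspace ℝ E), IsOpen U ∧ Convex ℝ U ∧ C = U ∩ F

open Classical in
/-- The Euler characteristic with compact supports of a relatively open convex set: `(-1) ^ dim C`,
and `0` for the empty set. -/
noncomputable def euler (C : Set E) : ℤ :=
  if C.Nonempty then (-1) ^ Module.finrank ℝ (vectorSpan ℝ C) else 0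

@[simp] theorem euler_empty : euler (∅ : Set E) = 0 := by simp [euler]

theorem euler_of_nonempty {C : Set E} (h : C.Nonempty) :
    euler C = (-1) ^ Module.finrank ℝ (vectorSpan ℝ C) := by simp [euler, h]

theorem IsRelOpenConvex.inter {C D : Set E} (hC : IsRelOpenConvex C) (hD : IsRelOpenConvex D) :
    IsRelOpenConvex (C ∩ D) := by
  obtain ⟨U, F, hU, hU', rfl⟩ := hC
  obtain ⟨V, G, hV, hV', rfl⟩ := hD
  refine ⟨U ∩ V, F ⊓ G, hU.inter hV, hU'.inter hV', ?_⟩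
  ext x
  simp only [Set.mem_inter_iff, SetLike.mem_coe, AffineSubspace.mem_inf_iff]
  tauto

theorem isRelOpenConvex_of_isOpen {U : Set E} (hU : IsOpen U) (hU' : Convex ℝ U) :
    IsRelOpenConvex U := ⟨U, ⊤, hU, hU', by simp⟩

theorem IsRelOpenConvex.convex {C : Set E} (hC : IsRelOpenConvex C) : Convex ℝ C := by
  obtain ⟨U, F, hU, hU', rfl⟩ := hC
  exact hU'.inter F.convex

theorem exists_pos_add_smul_mem {U : Set E} (hU : IsOpen U) {x : E} (hx : x ∈ U) (d : E) :
    ∃ ε : ℝ, 0 < ε ∧ x + ε • d ∈ U ∧ x - ε • d ∈ U := by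
  have h1 : Filter.Tendsto (fun ε : ℝ => x + ε • d) (𝓝[>] 0) (𝓝 x) := by
    have : Continuous (fun ε : ℝ => x + ε • d) := by fun_prop
    simpa using (this.tendsto 0).mono_left nhdsWithin_le_nhds
  have h2 : Filter.Tendsto (fun ε : ℝ => x - ε • d) (𝓝[>] 0) (𝓝 x) := by
    have : Continuous (fun ε : ℝ => x - ε • d) := by fun_prop
    simpa using (this.tendsto 0).mono_left nhdsWithin_le_nhds
  obtain ⟨ε, h, h', h''⟩ := ((h1.eventually_mem (hU.mem_nhds hx)).and
    ((h2.eventually_mem (hU.mem_nhds hx)).and self_mem_nhdsWithin)).exists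
  exact ⟨ε, h'', h, h'⟩

theorem vectorSpan_open_inter {U : Set E} (hU : IsOpen U) (F : AffineSubspace ℝ E)
    (h : (U ∩ F).Nonempty) : vectorSpan ℝ (U ∩ F : Set E) = F.direction := by
  apply le_antisymm
  · exact vectorSpan_mono ℝ Set.inter_subset_right
  · intro d hd
    obtain ⟨x, hxU, hxF⟩ := h
    obtain ⟨ε, hε, h1, -⟩ := exists_pos_add_smul_mem hU hxU d
    have hxF' : x + ε • d ∈ F := by
      rw [add_comm]
      exact AffineSubspace.vadd_mem_of_mem_direction (F.direction.smul_mem ε hd) hxF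
    have := vsub_mem_vectorSpan ℝ (show x + ε • d ∈ (U ∩ F : Set E) from ⟨h1, hxF'⟩)
      (show x ∈ (U ∩ F : Set E) from ⟨hxU, hxF⟩)
    simp only [vsub_eq_sub, add_sub_cancel_left] at this
    exact (Submodule.smul_mem_iff _ hε.ne').1 this

/-- Intersecting with an open set does not change the dimension, hence not the Euler characteristic
either, unless the result is empty. -/
theorem euler_inter_open {C U : Set E} (hC : IsRelOpenConvex C) (hU : IsOpen U)
    (h : (C ∩ U).Nonempty) : euler (C ∩ U) = euler C := by
  obtain ⟨V, F, hV, -, rfl⟩ := hC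
  rw [euler_of_nonempty h, euler_of_nonempty (h.mono Set.inter_subset_left),
    vectorSpan_open_inter hV F (h.mono Set.inter_subset_left)]
  rw [Set.inter_right_comm] at h ⊢
  rw [vectorSpan_open_inter (hV.inter hU) F h]

theorem finrank_inf_ker [FiniteDimensional ℝ E] (V : Submodule ℝ E) (l : E →ₗ[ℝ] ℝ) {d : E}
    (hd : d ∈ V) (hl : l d ≠ 0) :
    Module.finrank ℝ V = Module.finrank ℝ (V ⊓ LinearMap.ker l : Submodule ℝ E) + 1 := by
  have h := LinearMap.finrank_range_add_finrank_ker (l.domRestrict V)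
  have hr : LinearMap.range (l.domRestrict V) = ⊤ := by
    apply LinearMap.range_eq_top.2
    apply LinearMap.surjective
    intro h0
    exact hl (by simpa using LinearMap.congr_fun h0 ⟨d, hd⟩)
  rw [hr, finrank_top, Module.finrank_self] at h
  have hk : Module.finrank ℝ (LinearMap.ker (l.domRestrict V)) =
      Module.finrank ℝ (V ⊓ LinearMap.ker l : Submodule ℝ E) := by
    rw [LinearMap.ker_domRestrict]
    have e := Submodule.equivSubtypeMap V (Submodule.comap V.subtype (LinearMap.ker l))
    rw [e.finrank_eq, Submodule.map_comap_subtype]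
  omega

theorem isRelOpenConvex_zero (h : E →ᵃ[ℝ] ℝ) : IsRelOpenConvex {x | h x = 0} := by
  rcases Set.eq_empty_or_nonempty {x | h x = 0} with he | ⟨x₀, hx₀⟩
  · exact ⟨∅, ⊤, isOpen_empty, convex_empty, by simp [he]⟩
  · refine ⟨Set.univ, AffineSubspace.mk' x₀ (LinearMap.ker h.linear), isOpen_univ,
      convex_univ, ?_⟩
    ext x
    have : h.linear (x - x₀) = h x - h x₀ := by
      simpa using h.linearMap_vsub x x₀
    have hx₀' : h x₀ = 0 := hx₀
    simp only [Set.mem_ofPred_eq, Set.univ_inter, SetLike.mem_coe, AffineSubspace.mem_mk',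
      vsub_eq_sub, LinearMap.mem_ker, this, hx₀', sub_zero]

variable [FiniteDimensional ℝ E]

theorem isOpen_setOf_neg (h : E →ᵃ[ℝ] ℝ) : IsOpen {x | h x < 0} :=
  isOpen_lt h.continuous_of_finiteDimensional continuous_const

theorem isOpen_setOf_pos (h : E →ᵃ[ℝ] ℝ) : IsOpen {x | 0 < h x} :=
  isOpen_lt continuous_const h.continuous_of_finiteDimensional

theorem isRelOpenConvex_inter_neg {C : Set E} (hC : IsRelOpenConvex C) (h : E →ᵃ[ℝ] ℝ) :
    IsRelOpenConvex (C ∩ {x | h x < 0}) :=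
  hC.inter (isRelOpenConvex_of_isOpen (isOpen_setOf_neg h)
    ((convex_Iio (0 : ℝ)).affine_preimage h))

theorem isRelOpenConvex_inter_pos {C : Set E} (hC : IsRelOpenConvex C) (h : E →ᵃ[ℝ] ℝ) :
    IsRelOpenConvex (C ∩ {x | 0 < h x}) :=
  hC.inter (isRelOpenConvex_of_isOpen (isOpen_setOf_pos h)
    ((convex_Ioi (0 : ℝ)).affine_preimage h))

/-- If an affine functional vanishes at a point of a relatively open convex set `C` without being
constant on `C`, then both sides have the dimension of `C` and the section has dimension one less;
`(-1) ^ d = (-1) ^ d + (-1) ^ (d - 1) + (-1) ^ d`. -/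
theorem euler_cut {C : Set E} (hC : IsRelOpenConvex C) (h : E →ᵃ[ℝ] ℝ) :
    euler C = euler (C ∩ {x | h x < 0}) + euler (C ∩ {x | h x = 0}) +
      euler (C ∩ {x | 0 < h x}) := by
  by_cases hz : (C ∩ {x | h x = 0}).Nonempty
  swap
  · have hz' := Set.not_nonempty_iff_eq_empty.1 hz
    by_cases hn : (C ∩ {x | h x < 0}).Nonempty
    · by_cases hp : (C ∩ {x | 0 < h x}).Nonempty
      · exfalso
        obtain ⟨a, ha, ha'⟩ := hn
        obtain ⟨b, hb, hb'⟩ := hp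
        have hpre : IsPreconnected (h '' C) :=
          hC.convex.isPreconnected.image _ h.continuous_of_finiteDimensional.continuousOn
        obtain ⟨c, hc, hc'⟩ := hpre.Icc_subset (Set.mem_image_of_mem h ha)
          (Set.mem_image_of_mem h hb) ⟨le_of_lt ha', le_of_lt hb'⟩
        exact hz ⟨c, hc, hc'⟩
      · rw [hz', Set.not_nonempty_iff_eq_empty.1 hp,
          euler_inter_open hC (isOpen_setOf_neg h) hn]
        simp
    · rw [hz', Set.not_nonempty_iff_eq_empty.1 hn]
      by_cases hp : (C ∩ {x | 0 < h x}).Nonempty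
      · rw [euler_inter_open hC (isOpen_setOf_pos h) hp]
        simp
      · rw [Set.not_nonempty_iff_eq_empty.1 hp]
        have : C = ∅ := by
          by_contra hne
          obtain ⟨x, hx⟩ := Set.nonempty_iff_ne_empty.2 hne
          rcases lt_trichotomy (h x) 0 with h1 | h1 | h1
          · exact hn ⟨x, hx, h1⟩
          · exact hz ⟨x, hx, h1⟩
          · exact hp ⟨x, hx, h1⟩
        simp [this]
  obtain ⟨x₀, hx₀C, hx₀⟩ := hz
  have hx₀' : h x₀ = 0 := hx₀
  have hval : ∀ x, h x = h.linear (x - x₀) := by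
    intro x
    have : h.linear (x - x₀) = h x - h x₀ := by simpa using h.linearMap_vsub x x₀
    rw [this, hx₀', sub_zero]
  obtain ⟨U, F, hU, hU', rfl⟩ := hC
  by_cases hconst : ∀ d ∈ F.direction, h.linear d = 0
  · have hz : ∀ x ∈ (U ∩ F : Set E), h x = 0 := fun x hx => by
      rw [hval]
      exact hconst _ (AffineSubspace.vsub_mem_direction hx.2 hx₀C.2)
    have e1 : (U ∩ F : Set E) ∩ {x | h x < 0} = ∅ := by
      ext x; simp only [Set.mem_inter_iff, Set.mem_ofPred_eq, Set.mem_empty_iff_false, iff_false]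
      intro hx; have := hz x hx.1; have := hx.2; linarith
    have e2 : (U ∩ F : Set E) ∩ {x | 0 < h x} = ∅ := by
      ext x; simp only [Set.mem_inter_iff, Set.mem_ofPred_eq, Set.mem_empty_iff_false, iff_false]
      intro hx; have := hz x hx.1; have := hx.2; linarith
    have e3 : (U ∩ F : Set E) ∩ {x | h x = 0} = U ∩ F := Set.inter_eq_left.2 hz
    rw [e1, e2, e3]; simp
  push Not at hconst
  obtain ⟨d, hd, hld⟩ := hconst
  obtain ⟨ε, hε, hp, hm⟩ := exists_pos_add_smul_mem hU hx₀C.1 (h.linear d • d)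
  have hdF : ε • h.linear d • d ∈ F.direction :=
    F.direction.smul_mem _ (F.direction.smul_mem _ hd)
  have hsq : 0 < ε * (h.linear d * h.linear d) := mul_pos hε (mul_self_pos.2 hld)
  have hpos : ((U ∩ F : Set E) ∩ {x | 0 < h x}).Nonempty := by
    refine ⟨x₀ + ε • h.linear d • d, ⟨hp, ?_⟩, ?_⟩
    · rw [add_comm]; exact AffineSubspace.vadd_mem_of_mem_direction hdF hx₀C.2
    · simp [hval]; exact hsq
  have hneg : ((U ∩ F : Set E) ∩ {x | h x < 0}).Nonempty := by
    refine ⟨x₀ - ε • h.linear d • d, ⟨hm, ?_⟩, ?_⟩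
    · rw [sub_eq_neg_add]
      exact AffineSubspace.vadd_mem_of_mem_direction (neg_mem hdF) hx₀C.2
    · simp [hval]; exact hsq
  have hC' : IsRelOpenConvex (U ∩ F : Set E) := ⟨U, F, hU, hU', rfl⟩
  rw [euler_inter_open hC' (isOpen_setOf_neg h) hneg,
    euler_inter_open hC' (isOpen_setOf_pos h) hpos]
  have hF' : (U ∩ F : Set E) ∩ {x | h x = 0} =
      U ∩ (AffineSubspace.mk' x₀ (F.direction ⊓ LinearMap.ker h.linear) : Set E) := by
    ext x
    simp only [Set.mem_inter_iff, SetLike.mem_coe, Set.mem_ofPred_eq, AffineSubspace.mem_mk',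
      Submodule.mem_inf, LinearMap.mem_ker, vsub_eq_sub, hval x, and_assoc]
    have : x ∈ F ↔ x - x₀ ∈ F.direction := by
      rw [← vsub_eq_sub, AffineSubspace.vsub_right_mem_direction_iff_mem hx₀C.2]
    rw [this]
  rw [hF', euler_of_nonempty (C := U ∩ (AffineSubspace.mk' x₀ _ : Set E)) ⟨x₀, hx₀C.1, by simp⟩,
    vectorSpan_open_inter hU _ ⟨x₀, hx₀C.1, by simp⟩, AffineSubspace.direction_mk',
    euler_of_nonempty ⟨x₀, hx₀C⟩, vectorSpan_open_inter hU _ ⟨x₀, hx₀C⟩,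
    finrank_inf_ker F.direction h.linear hd hld, pow_succ]
  ring

/-- Finite additivity of `euler`: if a relatively open convex set `C` is partitioned by the sets
`D j`, and membership in `D j` depends only on the signs of finitely many affine functionals, then
`C` may be cut along these functionals one after the other. -/
theorem euler_eq_sum {ι : Type*} [Fintype ι] (D : ι → Set E) (hD : ∀ j, IsRelOpenConvex (D j))
    (Φ : List (E →ᵃ[ℝ] ℝ)) : ∀ C : Set E, IsRelOpenConvex C → (∀ x ∈ C, ∃! j, x ∈ D j) →
    (∀ j, ∀ x ∈ C, ∀ y ∈ C, (∀ h ∈ Φ, SignType.sign (h x) = SignType.sign (h y)) →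
      x ∈ D j → y ∈ D j) → euler C = ∑ j, euler (C ∩ D j) := by
  induction Φ with
  | nil =>
    intro C hC hu hm
    rcases Set.eq_empty_or_nonempty C with rfl | ⟨x, hx⟩
    · simp
    obtain ⟨j₀, hj₀, huniq⟩ := hu x hx
    rw [Finset.sum_eq_single j₀]
    · rw [Set.inter_eq_left.2 fun y hy => hm j₀ x hx y hy (by simp) hj₀]
    · intro j _ hj
      have : C ∩ D j = ∅ := by
        rw [← Set.not_nonempty_iff_eq_empty]
        rintro ⟨y, hy, hy'⟩
        exact hj (huniq j (hm j y hy x hx (by simp) hy'))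
      rw [this, euler_empty]
    · simp
  | cons h Φ ih =>
    intro C hC hu hm
    have key : ∀ S : Set E, IsRelOpenConvex (C ∩ S) →
        (∀ x ∈ S, ∀ y ∈ S, SignType.sign (h x) = SignType.sign (h y)) →
        euler (C ∩ S) = ∑ j, euler (C ∩ D j ∩ S) := by
      intro S hS hsign
      rw [ih _ hS (fun x hx => hu x hx.1)]
      · simp only [Set.inter_right_comm]
      · intro j x hx y hy hxy
        refine hm j x hx.1 y hy.1 fun h' hh' => ?_
        rcases List.mem_cons.1 hh' with rfl | hh'
        · exact hsign x hx.2 y hy.2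
        · exact hxy h' hh'
    rw [euler_cut hC h, key _ (isRelOpenConvex_inter_neg hC h),
      key _ (hC.inter (isRelOpenConvex_zero h)), key _ (isRelOpenConvex_inter_pos hC h),
      ← Finset.sum_add_distrib, ← Finset.sum_add_distrib]
    · exact Finset.sum_congr rfl fun j _ => (euler_cut (hC.inter (hD j)) h).symm
    · intro x hx y hy
      rw [sign_pos hx, sign_pos hy]
    · intro x hx y hy
      rw [show h x = 0 from hx, show h y = 0 from hy]
    · intro x hx y hy
      rw [sign_neg hx, sign_neg hy]

end Valuation

/-! ### Invariance of the local Euler characteristic -/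

section LocalEuler

variable {E : Type*} [NormedAddCommGroup E] [NormedSpace ℝ E]

/-- A nonempty relatively open convex set described by sign conditions on finitely many affine
functionals. -/
structure IsPolyCell (C : Set E) : Prop where
  nonempty : C.Nonempty
  relOpen : IsRelOpenConvex C
  signs : ∃ Φ : List (E →ᵃ[ℝ] ℝ), ∀ x y, (∀ h ∈ Φ, SignType.sign (h x) = SignType.sign (h y)) →
    x ∈ C → y ∈ C

/-- The sets `C i` form a partition of `A` into polyhedral cells. -/
structure IsCellPartition {ι : Type*} (C : ι → Set E) (A : Set E) : Prop where
  cell : ∀ i, IsPolyCell (C i)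
  existsUnique : ∀ x ∈ A, ∃! i, x ∈ C i
  subset : ∀ i, C i ⊆ A

open Classical in
theorem exists_ball_sum_euler_eq {ι : Type*} [Fintype ι] (C : ι → Set E)
    (hC : ∀ i, IsPolyCell (C i)) (x : E) : ∃ ε > 0, ∀ δ, 0 < δ → δ ≤ ε →
    ∑ i, euler (C i ∩ Metric.ball x δ) = ∑ i, if x ∈ closure (C i) then euler (C i) else 0 := by
  have h : ∀ᶠ δ in 𝓝[>] (0 : ℝ), ∀ i, x ∉ closure (C i) → C i ∩ Metric.ball x δ = ∅ := by
    rw [Filter.eventually_all]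
    intro i
    by_cases hx : x ∈ closure (C i)
    · simp [hx]
    · obtain ⟨ε, hε, hb⟩ := Metric.isOpen_iff.1 isClosed_closure.isOpen_compl x hx
      filter_upwards [Ioo_mem_nhdsGT hε] with δ hδ _
      rw [← Set.not_nonempty_iff_eq_empty]
      rintro ⟨y, hy, hy'⟩
      exact hb (Metric.ball_subset_ball hδ.2.le hy') (subset_closure hy)
  obtain ⟨ε, hε, hh⟩ := (mem_nhdsGT_iff_exists_Ioc_subset).1 h
  refine ⟨ε, hε, fun δ hδ hδε => Finset.sum_congr rfl fun i _ => ?_⟩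
  split_ifs with hx
  · refine euler_inter_open (hC i).relOpen Metric.isOpen_ball ?_
    obtain ⟨y, hy, hy'⟩ := Metric.mem_closure_iff.1 hx δ hδ
    exact ⟨y, hy, by rwa [Metric.mem_ball, dist_comm]⟩
  · rw [hh ⟨hδ, hδε⟩ i hx, euler_empty]

variable [FiniteDimensional ℝ E]

theorem sum_euler_inter_eq {ι κ : Type*} [Fintype ι] [Fintype κ] {C : ι → Set E} {D : κ → Set E}
    {A : Set E} (hC : IsCellPartition C A) (hD : IsCellPartition D A) {U : Set E}
    (hU : IsOpen U) (hU' : Convex ℝ U) :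
    ∑ i, euler (C i ∩ U) = ∑ i, ∑ j, euler (C i ∩ U ∩ D j) := by
  refine Finset.sum_congr rfl fun i _ => ?_
  choose Φ hΦ using fun j => (hD.cell j).signs
  refine euler_eq_sum D (fun j => (hD.cell j).relOpen) (Finset.univ.toList.flatMap Φ) _
    ((hC.cell i).relOpen.inter (isRelOpenConvex_of_isOpen hU hU'))
    (fun x hx => hD.existsUnique x (hC.subset i hx.1)) ?_
  intro j x _ y _ hxy
  exact hΦ j x y fun h hh => hxy h (List.mem_flatMap.2 ⟨j, by simp, hh⟩)

open Classical in
/-- The local Euler characteristic at `x`, the sum of `(-1) ^ dim` over the cells having `x` in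
their closure, is the same for any two partitions of `A` into polyhedral cells: both are the Euler
characteristic of `A ∩ U` for a small ball `U` about `x`. -/
theorem localEuler_eq {ι κ : Type*} [Fintype ι] [Fintype κ] {C : ι → Set E} {D : κ → Set E}
    {A : Set E} (hC : IsCellPartition C A) (hD : IsCellPartition D A) (x : E) :
    (∑ i, if x ∈ closure (C i) then euler (C i) else 0) =
      ∑ j, if x ∈ closure (D j) then euler (D j) else 0 := by
  obtain ⟨ε₁, h₁, hC'⟩ := exists_ball_sum_euler_eq C hC.cell x
  obtain ⟨ε₂, h₂, hD'⟩ := exists_ball_sum_euler_eq D hD.cell x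
  rw [← hC' (min ε₁ ε₂) (lt_min h₁ h₂) (min_le_left _ _),
    ← hD' (min ε₁ ε₂) (lt_min h₁ h₂) (min_le_right _ _),
    sum_euler_inter_eq hC hD Metric.isOpen_ball (convex_ball _ _),
    sum_euler_inter_eq hD hC Metric.isOpen_ball (convex_ball _ _), Finset.sum_comm]
  refine Finset.sum_congr rfl fun j _ => Finset.sum_congr rfl fun i _ => ?_
  congr 1
  ext y
  simp only [Set.mem_inter_iff]
  tauto

end LocalEuler

/-! ### Open and closed simplices -/

section Simplices

variable {E : Type*} [NormedAddCommGroup E] [NormedSpace ℝ E]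
variable {ι : Type*} [Fintype ι]

/-- The open simplex spanned by a finite family of points: all their convex combinations with
positive weights. -/
def openSimplex (v : ι → E) : Set E :=
  {x | ∃ w : ι → ℝ, (∀ i, 0 < w i) ∧ ∑ i, w i = 1 ∧ ∑ i, w i • v i = x}

/-- The closed simplex spanned by a finite family of points: all their convex combinations. -/
def closedSimplex (v : ι → E) : Set E :=
  {x | ∃ w : ι → ℝ, (∀ i, 0 ≤ w i) ∧ ∑ i, w i = 1 ∧ ∑ i, w i • v i = x}

theorem map_sum_smul {F : Type*} [AddCommGroup F] [Module ℝ F] (g : E →ᵃ[ℝ] F) (v : ι → E)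
    {w : ι → ℝ} (hw : ∑ i, w i = 1) : g (∑ i, w i • v i) = ∑ i, w i • g (v i) := by
  have h := Finset.map_affineCombination Finset.univ v w hw g
  rwa [Finset.affineCombination_eq_linear_combination _ _ _ hw,
    Finset.affineCombination_eq_linear_combination _ _ _ hw] at h

theorem openSimplex_subset_closedSimplex (v : ι → E) : openSimplex v ⊆ closedSimplex v :=
  fun _ ⟨w, hw, h⟩ => ⟨w, fun i => (hw i).le, h⟩

theorem openSimplex_nonempty [Nonempty ι] (v : ι → E) : (openSimplex v).Nonempty :=
  ⟨_, fun _ => (Fintype.card ι : ℝ)⁻¹, fun _ => by positivity, by simp, rfl⟩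

theorem isClosed_closedSimplex (v : ι → E) : IsClosed (closedSimplex v) := by
  have : closedSimplex v = (fun w : ι → ℝ => ∑ i, w i • v i) '' stdSimplex ℝ ι := by
    ext x
    constructor
    · rintro ⟨w, h1, h2, h3⟩
      exact ⟨w, ⟨h1, h2⟩, h3⟩
    · rintro ⟨w, ⟨h1, h2⟩, h3⟩
      exact ⟨w, h1, h2, h3⟩
  rw [this]
  exact ((isCompact_stdSimplex ℝ ι).image (by fun_prop)).isClosed

theorem closure_openSimplex [Nonempty ι] (v : ι → E) :
    closure (openSimplex v) = closedSimplex v := by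
  apply Set.Subset.antisymm
  · exact closure_minimal (openSimplex_subset_closedSimplex v) (isClosed_closedSimplex v)
  · rintro x ⟨w, hw, hs, hx⟩
    obtain ⟨c, u, hu, hus, hc⟩ := openSimplex_nonempty v
    have ht : Filter.Tendsto (fun ε : ℝ => (1 - ε) • x + ε • c) (𝓝[>] 0) (𝓝 x) := by
      have : Continuous (fun ε : ℝ => (1 - ε) • x + ε • c) := by fun_prop
      simpa using (this.tendsto 0).mono_left nhdsWithin_le_nhds
    refine mem_closure_of_tendsto ht ?_
    filter_upwards [Ioo_mem_nhdsGT (zero_lt_one' ℝ)] with ε hε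
    refine ⟨fun i => (1 - ε) * w i + ε * u i, fun i => ?_, ?_, ?_⟩
    · have h1 := mul_nonneg (sub_nonneg.2 hε.2.le) (hw i)
      have h2 := mul_pos hε.1 (hu i)
      linarith
    · rw [Finset.sum_add_distrib, ← Finset.mul_sum, ← Finset.mul_sum, hs, hus]; ring
    · simp only [add_smul, mul_smul, Finset.sum_add_distrib, ← Finset.smul_sum, hx, hc]

theorem isRelOpenConvex_iInter {κ : Type*} [Finite κ] {C : κ → Set E}
    (h : ∀ k, IsRelOpenConvex (C k)) : IsRelOpenConvex (⋂ k, C k) := by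
  choose U F hU hU' hC using h
  refine ⟨⋂ k, U k, ⨅ k, F k, isOpen_iInter_of_finite hU, convex_iInter hU', ?_⟩
  ext x
  simp only [hC, Set.mem_iInter, Set.mem_inter_iff, SetLike.mem_coe, AffineSubspace.mem_iInf_iff,
    forall_and]

variable [FiniteDimensional ℝ E]

/-- Extending the vertices to an affine basis, the open simplex is given by the signs of the
barycentric coordinates. -/
theorem isPolyCell_openSimplex [Nonempty ι] {v : ι → E} (hv : AffineIndependent ℝ v) :
    IsPolyCell (openSimplex v) := by
  classical
  obtain ⟨t, hst, hti, htt⟩ := exists_subset_affineIndependent_affineSpan_eq_top hv.range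
  let b : AffineBasis t ℝ E := ⟨(↑), hti, by simpa using htt⟩
  have : Finite t := finite_of_fin_dim_affineIndependent ℝ hti
  have := Fintype.ofFinite t
  let e : ι → t := fun i => ⟨v i, hst ⟨i, rfl⟩⟩
  have he : Function.Injective e := fun i j hij => hv.injective (congrArg Subtype.val hij)
  have hb : ∀ i, b (e i) = v i := fun i => rfl
  have hmem : ∀ x, x ∈ openSimplex v ↔ ∀ j : t, (j ∈ Set.range e → 0 < b.coord j x) ∧
      (j ∉ Set.range e → b.coord j x = 0) := by
    intro x
    constructor
    · rintro ⟨w, hw, hs, rfl⟩ j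
      rw [map_sum_smul _ _ hs]
      simp only [← hb, b.coord_apply, smul_eq_mul, mul_ite, mul_one, mul_zero]
      constructor
      · rintro ⟨i, rfl⟩
        simp only [he.eq_iff]
        simpa using hw i
      · intro hj
        refine Finset.sum_eq_zero fun i _ => if_neg ?_
        rintro rfl
        exact hj ⟨i, rfl⟩
    · intro h
      refine ⟨fun i => b.coord (e i) x, fun i => (h _).1 ⟨i, rfl⟩, ?_, ?_⟩
      · rw [← b.sum_coord_apply_eq_one x]
        exact Finset.sum_of_injOn e he.injOn (by simp) (fun j _ hj => (h j).2 (by simpa using hj))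
          (fun _ _ => rfl)
      · conv_rhs => rw [← b.linear_combination_coord_eq_self x]
        exact Finset.sum_of_injOn e he.injOn (by simp)
          (fun j _ hj => by rw [(h j).2 (by simpa using hj), zero_smul]) (fun _ _ => rfl)
  refine ⟨openSimplex_nonempty v, ?_, Finset.univ.toList.map b.coord, ?_⟩
  · have : openSimplex v =
        ⋂ j : t, if j ∈ Set.range e then {x | 0 < b.coord j x} else {x | b.coord j x = 0} := by
      ext x
      rw [hmem, Set.mem_iInter]
      refine forall_congr' fun j => ?_
      split_ifs with hj <;> simp [hj]
    rw [this]
    refine isRelOpenConvex_iInter fun j => ?_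
    split_ifs
    · exact isRelOpenConvex_of_isOpen (isOpen_setOf_pos _)
        ((convex_Ioi (0 : ℝ)).affine_preimage (b.coord j))
    · exact isRelOpenConvex_zero _
  · intro x y hxy hx
    rw [hmem] at hx ⊢
    intro j
    have hj := hxy (b.coord j) (by simp)
    refine ⟨fun hr => ?_, fun hr => ?_⟩
    · rw [sign_pos ((hx j).1 hr)] at hj
      exact sign_eq_one_iff.1 hj.symm
    · rw [(hx j).2 hr, sign_zero] at hj
      exact sign_eq_zero_iff.1 hj.symm

theorem euler_openSimplex [Nonempty ι] {v : ι → E} (hv : AffineIndependent ℝ v) :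
    euler (openSimplex v) = (-1) ^ (Fintype.card ι + 1) := by
  have h1 : affineSpan ℝ (openSimplex v) = affineSpan ℝ (Set.range v) := by
    apply le_antisymm
    · rw [affineSpan_le]
      rintro x ⟨w, -, hs, rfl⟩
      rw [← Finset.affineCombination_eq_linear_combination _ _ _ hs]
      exact affineCombination_mem_affineSpan hs v
    · rw [affineSpan_le]
      have hcl : IsClosed (affineSpan ℝ (openSimplex v) : Set E) :=
        AffineSubspace.closed_of_finiteDimensional _
      refine Set.Subset.trans ?_ (closure_minimal (subset_affineSpan ℝ _) hcl)
      rw [closure_openSimplex]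
      rintro _ ⟨i, rfl⟩
      classical
      exact ⟨Pi.single i 1, fun j => by rw [Pi.single_apply]; split_ifs <;> simp, by simp,
        by simp [Pi.single_apply]⟩
  obtain ⟨n, hn⟩ : ∃ n, Fintype.card ι = n + 1 :=
    Nat.exists_eq_succ_of_ne_zero Fintype.card_ne_zero
  rw [euler_of_nonempty (openSimplex_nonempty v), ← direction_affineSpan, h1,
    direction_affineSpan, hv.finrank_vectorSpan hn, hn, add_assoc, pow_add]
  simp

end Simplices

section Triangulations

variable {E : Type*} [NormedAddCommGroup E] [NormedSpace ℝ E]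

theorem sum_coe_ite_smul {α G : Type*} [DecidableEq α] [AddCommGroup G] [Module ℝ G]
    (p q : Finset α) (c : α → ℝ) (f : α → G) :
    ∑ i : p, (if (i : α) ∈ q then c i else 0) • f i = ∑ y ∈ p ∩ q, c y • f y := by
  rw [Finset.sum_coe_sort p (fun y => (if y ∈ q then c y else 0) • f y),
    ← Finset.filter_mem_eq_inter, Finset.sum_filter]
  refine Finset.sum_congr rfl fun y _ => ?_
  split_ifs <;> simp

/-- The carrier of a geometric simplicial complex is partitioned by its open simplices. -/
theorem existsUnique_mem_openSimplex (K : Geometry.SimplicialComplex ℝ E) {x : E}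
    (hx : x ∈ K.space) :
    ∃! s : K.faces, x ∈ openSimplex (fun i : (s : Finset E) => (i : E)) := by
  classical
  obtain ⟨s, hs, hxs⟩ := Geometry.SimplicialComplex.mem_space_iff.1 hx
  rw [Finset.mem_convexHull'] at hxs
  obtain ⟨w, hw, hsum, hwx⟩ := hxs
  let t := s.filter fun y => 0 < w y
  have hz : ∀ y ∈ s, y ∉ t → w y = 0 := fun y hy hyt => by
    by_contra h
    exact hyt (Finset.mem_filter.2 ⟨hy, lt_of_le_of_ne (hw y hy) (Ne.symm h)⟩)
  have ht1 : ∑ y ∈ t, w y = 1 := by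
    rw [← hsum]
    exact Finset.sum_subset (Finset.filter_subset _ _) hz
  have ht2 : ∑ y ∈ t, w y • y = x := by
    rw [← hwx]
    exact Finset.sum_subset (Finset.filter_subset _ _) fun y hy hyt => by
      rw [hz y hy hyt, zero_smul]
  have htne : t.Nonempty := by
    rw [Finset.nonempty_iff_ne_empty]
    intro h
    simp [h] at ht1
  have hxt : t ∈ K.faces := K.down_closed hs (Finset.filter_subset _ _) htne
  have hx' : x ∈ openSimplex (fun i : t => (i : E)) := by
    refine ⟨fun i => w i, fun i => (Finset.mem_filter.1 i.2).2, ?_, ?_⟩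
    · rw [← ht1]; exact Finset.sum_coe_sort t w
    · rw [← ht2]; exact Finset.sum_coe_sort t (fun y => w y • y)
  -- two open simplices sharing a point: each vertex set is contained in the other
  have key : ∀ p q : K.faces, x ∈ openSimplex (fun i : (p : Finset E) => (i : E)) →
      x ∈ openSimplex (fun i : (q : Finset E) => (i : E)) → (p : Finset E) ⊆ q := by
    rintro ⟨p, hp⟩ ⟨q, hq⟩ ⟨u, hu, hus, hux⟩ ⟨u', hu', hus', hux'⟩
    have hxp : x ∈ convexHull ℝ (p : Set E) := by
      rw [← hux]
      exact (convex_convexHull ℝ _).sum_mem (fun i _ => (hu i).le) hus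
        fun i _ => subset_convexHull ℝ _ i.2
    have hxq : x ∈ convexHull ℝ (q : Set E) := by
      rw [← hux']
      exact (convex_convexHull ℝ _).sum_mem (fun i _ => (hu' i).le) hus'
        fun i _ => subset_convexHull ℝ _ i.2
    have hpq := K.inter_subset_convexHull hp hq ⟨hxp, hxq⟩
    rw [← Finset.coe_inter, Finset.mem_convexHull'] at hpq
    obtain ⟨c, -, hc1, hc2⟩ := hpq
    have hsub : p ∩ q ⊆ p := Finset.inter_subset_left
    have hext := sum_coe_ite_smul p q c (G := ℝ) (fun _ => 1)
    have hext' := sum_coe_ite_smul p q c (G := E) (fun y => y)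
    have hext1 : ∑ i : p, (if (i : E) ∈ q then c i else 0) = 1 := by
      rw [← hc1]; simpa using hext
    have heq := (affineIndependent_iff_eq_of_fintype_affineCombination_eq ℝ
      (fun i : p => (i : E))).1 (K.indep hp) u (fun i => if (i : E) ∈ q then c i else 0) hus
      hext1 (by
        rw [Finset.affineCombination_eq_linear_combination _ _ _ hus,
          Finset.affineCombination_eq_linear_combination _ _ _ hext1, hux, ← hc2]
        exact hext'.symm)
    intro y hy
    by_contra hyq
    have := congrFun heq ⟨y, hy⟩
    simp only [hyq, if_false] at this
    exact (hu ⟨y, hy⟩).ne' this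
  refine ⟨⟨t, hxt⟩, hx', fun q hq => ?_⟩
  exact Subtype.ext (Finset.Subset.antisymm (key q ⟨t, hxt⟩ hq hx') (key ⟨t, hxt⟩ q hx' hq))

end Triangulations

/-! ### Realizations of abstract simplicial complexes -/

section StandardSimplices

variable {V : Type*}

open Classical

/-- The vertices of the face of the standard simplex indexed by `c`. -/
noncomputable def stdVertices (c : Finset V) (i : c) : V → ℝ := Pi.single (i : V) 1

theorem affineIndependent_stdVertices [Fintype V] (c : Finset V) :
    AffineIndependent ℝ (stdVertices c) := by
  have h := (Pi.basisFun ℝ V).linearIndependent.affineIndependent.comp_embedding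
    (Function.Embedding.subtype (· ∈ c))
  have he : stdVertices c = Pi.basisFun ℝ V ∘ Function.Embedding.subtype (· ∈ c) := by
    funext i
    simp [stdVertices]
  rw [he]
  exact h

/-- The support of a vector, as a finset. -/
noncomputable def supp [Fintype V] (x : V → ℝ) : Finset V := Finset.univ.filter fun a => x a ≠ 0

theorem mem_supp [Fintype V] {x : V → ℝ} {a : V} : a ∈ supp x ↔ x a ≠ 0 := by simp [supp]

theorem sum_smul_stdVertices (c : Finset V) (w : c → ℝ) (a : V) :
    (∑ i, w i • stdVertices c i) a = if h : a ∈ c then w ⟨a, h⟩ else 0 := by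
  simp only [Finset.sum_apply, Pi.smul_apply, stdVertices, Pi.single_apply, smul_eq_mul, mul_ite,
    mul_one, mul_zero]
  split_ifs with h
  · rw [Finset.sum_eq_single ⟨a, h⟩]
    · simp
    · intro b _ hb
      exact if_neg fun hab => hb (Subtype.ext hab.symm)
    · simp
  · refine Finset.sum_eq_zero fun b _ => if_neg ?_
    rintro rfl
    exact h b.2

variable [Fintype V]

theorem sum_coe_eq_of_supp_subset {c : Finset V} {x : V → ℝ} (h : supp x ⊆ c) :
    ∑ i : c, x i = ∑ a, x a := by
  rw [Finset.sum_coe_sort c x]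
  refine Finset.sum_subset (Finset.subset_univ c) fun a _ ha => ?_
  by_contra hne
  exact ha (h (mem_supp.2 hne))

theorem sum_dite_mem (c : Finset V) (w : c → ℝ) :
    ∑ a, (if h : a ∈ c then w ⟨a, h⟩ else 0) = ∑ i, w i := by
  rw [← Finset.sum_subset (Finset.subset_univ c) (fun a _ ha => dif_neg ha),
    ← Finset.sum_coe_sort c]
  exact Finset.sum_congr rfl fun i _ => dif_pos i.2

theorem mem_openSimplex_stdVertices {c : Finset V} {x : V → ℝ} :
    x ∈ openSimplex (stdVertices c) ↔ (∀ a, 0 ≤ x a) ∧ ∑ a, x a = 1 ∧ supp x = c := by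
  constructor
  · rintro ⟨w, hw, hs, rfl⟩
    refine ⟨fun a => ?_, ?_, ?_⟩
    · rw [sum_smul_stdVertices]
      split_ifs with h
      · exact (hw _).le
      · exact le_rfl
    · simp only [sum_smul_stdVertices]
      rw [sum_dite_mem, hs]
    · ext a
      rw [mem_supp, sum_smul_stdVertices]
      by_cases h : a ∈ c
      · simpa [h] using (hw _).ne'
      · simp [h]
  · rintro ⟨h0, h1, rfl⟩
    refine ⟨fun i => x i, fun i => lt_of_le_of_ne (h0 i) (Ne.symm (mem_supp.1 i.2)), ?_, ?_⟩
    · rw [sum_coe_eq_of_supp_subset subset_rfl, h1]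
    · ext a
      rw [sum_smul_stdVertices]
      split_ifs with h
      · rfl
      · rw [mem_supp, not_not] at h; exact h.symm

theorem mem_closedSimplex_stdVertices {c : Finset V} {x : V → ℝ} (h0 : ∀ a, 0 ≤ x a)
    (h1 : ∑ a, x a = 1) : x ∈ closedSimplex (stdVertices c) ↔ supp x ⊆ c := by
  constructor
  · rintro ⟨w, hw, hs, rfl⟩ a ha
    rw [mem_supp, sum_smul_stdVertices] at ha
    by_contra h
    simp [h] at ha
  · intro h
    refine ⟨fun i => x i, fun i => h0 i, ?_, ?_⟩
    · rw [sum_coe_eq_of_supp_subset h, h1]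
    · ext a
      rw [sum_smul_stdVertices]
      split_ifs with h'
      · rfl
      · by_contra hne
        exact h' (h (mem_supp.2 (Ne.symm hne)))

/-- The geometric realization, in the standard simplex, of the abstract simplicial complex whose
faces are described by the predicate `p`. -/
def realization (p : Finset V → Prop) : Set (V → ℝ) :=
  {x | (∀ a, 0 ≤ x a) ∧ ∑ a, x a = 1 ∧ p (supp x)}

theorem isCellPartition_realization {p : Finset V → Prop} (hp : ∀ c, p c → c.Nonempty) :
    IsCellPartition (fun c : {c // p c} => openSimplex (stdVertices (c : Finset V)))
      (realization p) where
  cell c := by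
    have : Nonempty (c : Finset V) := (hp c c.2).to_subtype
    exact isPolyCell_openSimplex (affineIndependent_stdVertices _)
  existsUnique := by
    rintro x ⟨h0, h1, h2⟩
    refine ⟨⟨supp x, h2⟩, mem_openSimplex_stdVertices.2 ⟨h0, h1, rfl⟩, fun c hc => ?_⟩
    exact Subtype.ext (mem_openSimplex_stdVertices.1 hc).2.2.symm
  subset := by
    intro c x hx
    obtain ⟨h0, h1, h2⟩ := mem_openSimplex_stdVertices.1 hx
    exact ⟨h0, h1, h2 ▸ c.2⟩

/-- The local Euler characteristic of the realization of an abstract simplicial complex, as a sum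
over the faces containing the support of the point. -/
theorem localEuler_realization {p : Finset V → Prop} [Fintype {c // p c}]
    (hp : ∀ c, p c → c.Nonempty) {x : V → ℝ} (hx : x ∈ realization p)
    {T : Finset (Finset V)} (hT : ∀ c, c ∈ T ↔ p c ∧ supp x ⊆ c) :
    (∑ c : {c // p c}, if x ∈ closure (openSimplex (stdVertices (c : Finset V))) then
      euler (openSimplex (stdVertices (c : Finset V))) else 0) =
    ∑ c ∈ T, (-1 : ℤ) ^ (c.card + 1) := by
  obtain ⟨h0, h1, -⟩ := hx
  have h : ∀ c : Finset V, c.Nonempty → (if x ∈ closure (openSimplex (stdVertices c)) then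
      euler (openSimplex (stdVertices c)) else 0) =
      if supp x ⊆ c then (-1 : ℤ) ^ (c.card + 1) else 0 := by
    intro c hc
    have : Nonempty c := hc.to_subtype
    have e1 := closure_openSimplex (stdVertices c)
    have e2 := euler_openSimplex (affineIndependent_stdVertices c)
    have e3 := mem_closedSimplex_stdVertices (c := c) h0 h1
    rw [Fintype.card_coe] at e2
    rw [e1, e2]
    exact if_congr e3 rfl rfl
  have h' : ∀ c : {c // p c}, (if x ∈ closure (openSimplex (stdVertices (c : Finset V))) then
      euler (openSimplex (stdVertices (c : Finset V))) else 0) =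
      if supp x ⊆ c then (-1 : ℤ) ^ ((c : Finset V).card + 1) else 0 :=
    fun c => h c.1 (hp c.1 c.2)
  rw [Fintype.sum_congr _ _ h', ← Finset.sum_filter]
  refine Finset.sum_bij (fun c _ => (c : Finset V)) ?_ ?_ ?_ ?_
  · intro c hc
    exact (hT _).2 ⟨c.2, (Finset.mem_filter.1 hc).2⟩
  · intro c _ c' _ hcc
    exact Subtype.ext hcc
  · intro c hc
    exact ⟨⟨c, ((hT c).1 hc).1⟩, Finset.mem_filter.2 ⟨Finset.mem_univ _, ((hT c).1 hc).2⟩, rfl⟩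
  · intro c _
    rfl

end StandardSimplices

/-! ### PL invariance of the local Euler characteristic -/

section Transfer

variable {E F : Type*} [NormedAddCommGroup E] [NormedSpace ℝ E]
  [NormedAddCommGroup F] [NormedSpace ℝ F] {ι : Type*} [Fintype ι]

/-- An affine map that is injective on an open simplex maps its vertices to affinely independent
points: an affine dependence of the images could be added to the barycentre. -/
theorem affineIndependent_comp_of_injOn [Nonempty ι] {v : ι → E} (hv : AffineIndependent ℝ v)
    (g : E →ᵃ[ℝ] F) (hg : Set.InjOn g (openSimplex v)) : AffineIndependent ℝ (g ∘ v) := by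
  classical
  rw [affineIndependent_iff_of_fintype]
  intro w hw hwv i
  rw [Finset.weightedVSub_eq_linear_combination _ hw] at hwv
  set u : ℝ := (Fintype.card ι : ℝ)⁻¹ with hu
  have hupos : 0 < u := by positivity
  have husum : ∑ _i : ι, u = 1 := by simp [hu]
  have hev : ∀ᶠ ε in 𝓝[>] (0 : ℝ), ∀ i, 0 < u + ε * w i := by
    rw [Filter.eventually_all]
    intro i
    have hc : Continuous fun ε : ℝ => u + ε * w i := by fun_prop
    have ht : Filter.Tendsto (fun ε : ℝ => u + ε * w i) (𝓝[>] 0) (𝓝 u) := by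
      simpa using (hc.tendsto 0).mono_left nhdsWithin_le_nhds
    exact ht.eventually_const_lt hupos
  obtain ⟨ε, hε, hε0⟩ := (hev.and self_mem_nhdsWithin).exists
  have hsum' : ∑ i, (u + ε * w i) = 1 := by
    rw [Finset.sum_add_distrib, ← Finset.mul_sum, hw, husum]; ring
  have h1 : ∑ i, (u + ε * w i) • v i = ∑ i, u • v i := by
    refine hg ⟨_, hε, hsum', rfl⟩ ⟨_, fun _ => hupos, husum, rfl⟩ ?_
    rw [map_sum_smul g v hsum', map_sum_smul g v husum]
    simp only [add_smul, Finset.sum_add_distrib, mul_smul, ← Finset.smul_sum]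
    simp only [Function.comp_apply] at hwv
    rw [hwv]; simp
  have h2 := (affineIndependent_iff_eq_of_fintype_affineCombination_eq ℝ v).1 hv
    _ _ hsum' husum (by
      rw [Finset.affineCombination_eq_linear_combination _ _ _ hsum',
        Finset.affineCombination_eq_linear_combination _ _ _ husum]
      exact h1)
  have h3 := congrFun h2 i
  have h4 : ε * w i = 0 := by linarith
  exact (mul_eq_zero.1 h4).resolve_left (ne_of_gt hε0)

theorem closedSimplex_coe_subset_convexHull (s : Finset E) :
    closedSimplex (fun i : s => (i : E)) ⊆ convexHull ℝ (s : Set E) := by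
  rintro x ⟨w, hw, hs, rfl⟩
  exact (convex_convexHull ℝ _).sum_mem (fun i _ => hw i) hs fun i _ => subset_convexHull ℝ _ i.2

open Classical in
/-- The local Euler characteristic is a PL invariant: a PL homeomorphism maps the simplices of the
triangulation on which it is affine to the simplices of a triangulation of the image. -/
theorem localEuler_eq_of_homeomorph [FiniteDimensional ℝ E] [FiniteDimensional ℝ F]
    {A : Set E} {B : Set F} (f : A ≃ₜ B) (K : Geometry.SimplicialComplex ℝ E)
    (hfin : K.faces.Finite) (hKA : K.space = A)
    (haff : ∀ s ∈ K.faces, ∃ g : E →ᵃ[ℝ] F, ∀ x : A, (x : E) ∈ convexHull ℝ (s : Set E) →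
        (f x : F) = g x)
    {κ μ : Type*} [Fintype κ] [Fintype μ] {C : κ → Set E} {D : μ → Set F}
    (hC : IsCellPartition C A) (hD : IsCellPartition D B) (x : A) :
    (∑ i, if (x : E) ∈ closure (C i) then euler (C i) else 0) =
      ∑ j, if (f x : F) ∈ closure (D j) then euler (D j) else 0 := by
  have := hfin.fintype
  choose! g hg using haff
  have hne : ∀ s : K.faces, Nonempty (s : Finset E) := fun s =>
    (K.nonempty_of_mem_faces s.2).to_subtype
  have hsubA : ∀ s : K.faces, closedSimplex (fun i : (s : Finset E) => (i : E)) ⊆ A := fun s =>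
    hKA ▸ (closedSimplex_coe_subset_convexHull _).trans
      (Geometry.SimplicialComplex.convexHull_subset_space s.2)
  have hgf : ∀ s : K.faces, ∀ y (hy : y ∈ closedSimplex (fun i : (s : Finset E) => (i : E))),
      (f ⟨y, hsubA s hy⟩ : F) = g s y := fun s y hy =>
    hg s s.2 ⟨y, hsubA s hy⟩ (closedSimplex_coe_subset_convexHull _ hy)
  have hinj : ∀ s : K.faces, Set.InjOn (g s) (closedSimplex (fun i : (s : Finset E) => (i : E))) :=
    fun s y hy z hz hyz => by
      rw [← hgf s y hy, ← hgf s z hz] at hyz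
      exact congrArg Subtype.val (f.injective (Subtype.ext hyz))
  have hind : ∀ s : K.faces, AffineIndependent ℝ (fun i : (s : Finset E) => g s i) := fun s =>
    affineIndependent_comp_of_injOn (K.indep s.2) (g s)
      ((hinj s).mono (openSimplex_subset_closedSimplex _))
  have hopen : ∀ s : K.faces, ∀ y : A, (y : E) ∈ openSimplex (fun i : (s : Finset E) => (i : E)) ↔
      (f y : F) ∈ openSimplex (fun i : (s : Finset E) => g s i) := by
    intro s y
    constructor
    · rintro ⟨w, hw, hs, hy⟩
      refine ⟨w, hw, hs, ?_⟩
      rw [hgf s y ⟨w, fun i => (hw i).le, hs, hy⟩, ← hy, map_sum_smul _ _ hs]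
    · rintro ⟨w, hw, hs, hy⟩
      have hz : ∑ i, w i • (i : E) ∈ closedSimplex (fun i : (s : Finset E) => (i : E)) :=
        ⟨w, fun i => (hw i).le, hs, rfl⟩
      have hfz : f y = f ⟨_, hsubA s hz⟩ := by
        apply Subtype.ext
        rw [hgf s _ hz, ← hy, map_sum_smul _ _ hs]
      rw [f.injective hfz]
      exact ⟨w, hw, hs, rfl⟩
  have hclosed : ∀ s : K.faces, ∀ y : A,
      (y : E) ∈ closedSimplex (fun i : (s : Finset E) => (i : E)) ↔
      (f y : F) ∈ closedSimplex (fun i : (s : Finset E) => g s i) := by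
    intro s y
    constructor
    · rintro ⟨w, hw, hs, hy⟩
      refine ⟨w, hw, hs, ?_⟩
      rw [hgf s y ⟨w, hw, hs, hy⟩, ← hy, map_sum_smul _ _ hs]
    · rintro ⟨w, hw, hs, hy⟩
      have hz : ∑ i, w i • (i : E) ∈ closedSimplex (fun i : (s : Finset E) => (i : E)) :=
        ⟨w, hw, hs, rfl⟩
      have hfz : f y = f ⟨_, hsubA s hz⟩ := by
        apply Subtype.ext
        rw [hgf s _ hz, ← hy, map_sum_smul _ _ hs]
      rw [f.injective hfz]
      exact hz
  have hKC : IsCellPartition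
      (fun s : K.faces => openSimplex (fun i : (s : Finset E) => (i : E))) A :=
    { cell := fun s => isPolyCell_openSimplex (K.indep s.2)
      existsUnique := fun y hy => existsUnique_mem_openSimplex K (hKA ▸ hy)
      subset := fun s => (openSimplex_subset_closedSimplex _).trans (hsubA s) }
  have hKD : IsCellPartition
      (fun s : K.faces => openSimplex (fun i : (s : Finset E) => g s i)) B :=
    { cell := fun s => isPolyCell_openSimplex (hind s)
      existsUnique := by
        intro y hy
        obtain ⟨z, hz⟩ := f.surjective ⟨y, hy⟩
        have hzy : (f z : F) = y := by rw [hz]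
        obtain ⟨s, hs, hs'⟩ := hKC.existsUnique z z.2
        refine ⟨s, by rw [← hzy]; exact (hopen s z).1 hs, fun t ht => hs' t ?_⟩
        exact (hopen t z).2 (by rw [hzy]; exact ht)
      subset := by
        rintro s _ ⟨w, hw, hs, rfl⟩
        have hz : ∑ i, w i • (i : E) ∈ closedSimplex (fun i : (s : Finset E) => (i : E)) :=
          ⟨w, fun i => (hw i).le, hs, rfl⟩
        rw [← map_sum_smul (g s) (fun i : (s : Finset E) => (i : E)) hs, ← hgf s _ hz]
        exact (f _).2 }
  rw [localEuler_eq hC hKC, ← localEuler_eq hKD hD]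
  refine Finset.sum_congr rfl fun s _ => ?_
  rw [closure_openSimplex, closure_openSimplex, euler_openSimplex (K.indep s.2),
    euler_openSimplex (hind s), hclosed s x]

end Transfer

/-! ### Order complexes that are PL spheres -/

section OrderComplex

open CellCx

variable {P : Type*} [PartialOrder P]

theorem orderComplexCarrier_eq [Fintype P] : orderComplexCarrier P =
    realization fun c : Finset P => c.Nonempty ∧ IsChain (· ≤ ·) (c : Set P) := by
  ext x
  have hs : (supp x : Set P) = Function.support x := by
    ext a; simp [mem_supp]
  simp only [orderComplexCarrier, realization, Set.mem_ofPred_eq, finsum_eq_sum_of_fintype, hs]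
  refine and_congr_right fun _ => and_congr_right fun h1 => ?_
  refine (and_iff_right ?_).symm
  rw [Finset.nonempty_iff_ne_empty]
  intro h
  have : ∀ a, x a = 0 := fun a => by
    by_contra hne
    simpa [h] using mem_supp.2 hne
  simp [this] at h1

theorem stdPLSphere_eq (d : ℕ) : stdPLSphere d =
    realization fun c : Finset (Fin (d + 1)) => c.Nonempty ∧ c ≠ Finset.univ := by
  ext x
  simp only [stdPLSphere, realization, stdSimplex, Set.mem_ofPred_eq, and_assoc]
  refine and_congr_right fun _ => and_congr_right fun h1 => ?_
  have hne : (supp x).Nonempty := by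
    rw [Finset.nonempty_iff_ne_empty]
    intro h
    have : ∀ a, x a = 0 := fun a => by
      by_contra hne
      simpa [h] using mem_supp.2 hne
    simp [this] at h1
  simp only [hne, true_and, ne_eq, Finset.eq_univ_iff_forall, mem_supp, not_forall, not_not]

/-- The local Euler characteristic of the boundary of the standard simplex, combinatorially. -/
theorem sum_ssubset_univ {d : ℕ} {s : Finset (Fin (d + 1))} (hs : s.Nonempty)
    (hs' : s ≠ Finset.univ) :
    ∑ c : Finset (Fin (d + 1)) with (c.Nonempty ∧ c ≠ Finset.univ) ∧ s ⊆ c,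
      (-1 : ℤ) ^ (c.card + 1) = (-1) ^ (d + 1) := by
  have h : ∑ c : Finset (Fin (d + 1)) with s ⊆ c, (-1 : ℤ) ^ (c.card + 1) = 0 := by
    have h1 : ∑ c ∈ sᶜ.powerset, (-1 : ℤ) ^ ((s ∪ c).card + 1) = 0 := by
      have h2 : ∀ c ∈ sᶜ.powerset, (-1 : ℤ) ^ ((s ∪ c).card + 1) =
          (-1) ^ (s.card + 1) * (-1) ^ c.card := by
        intro c hc
        rw [Finset.card_union_of_disjoint, ← pow_add]
        · congr 1; omega
        · exact disjoint_compl_right.mono_right (Finset.mem_powerset.1 hc)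
      rw [Finset.sum_congr rfl h2, ← Finset.mul_sum,
        Finset.sum_powerset_neg_one_pow_card_of_nonempty, mul_zero]
      rw [Finset.nonempty_iff_ne_empty, ne_eq, Finset.compl_eq_empty_iff]
      exact hs'
    rw [← h1]
    refine Finset.sum_nbij' (fun c => c \ s) (fun c => s ∪ c) ?_ ?_ ?_ ?_ ?_
    · intro c _
      simp only [Finset.mem_powerset]
      intro a ha
      simp only [Finset.mem_sdiff] at ha
      simp [ha.2]
    · intro c _; simp
    · intro c hc
      exact Finset.union_sdiff_of_subset (by simpa using hc)
    · intro c hc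
      rw [Finset.union_sdiff_left]
      exact Finset.sdiff_eq_self_of_disjoint
        (disjoint_compl_left.mono_left (Finset.mem_powerset.1 hc))
    · intro c hc
      rw [Finset.union_sdiff_of_subset (by simpa using hc)]
  rw [← Finset.sum_erase_add _ _ (show (Finset.univ : Finset (Fin (d + 1))) ∈
    Finset.univ.filter (s ⊆ ·) by simp)] at h
  have he : Finset.univ.filter (fun c : Finset (Fin (d + 1)) =>
      (c.Nonempty ∧ c ≠ Finset.univ) ∧ s ⊆ c) =
      (Finset.univ.filter (s ⊆ ·)).erase Finset.univ := by
    ext c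
    simp only [Finset.mem_filter, Finset.mem_univ, true_and, Finset.mem_erase]
    constructor
    · tauto
    · exact fun h => ⟨⟨hs.mono h.2, h.1⟩, h.2⟩
  rw [he, eq_neg_of_add_eq_zero_left h, Finset.card_univ, Fintype.card_fin, pow_succ _ (d + 1)]
  ring

open Classical in
/-- If the order complex of a finite poset is a PL sphere of dimension `d - 1`, then the local
Euler characteristic at every point is `(-1) ^ (d - 1)`; at an interior point of the simplex with
vertices `c₀` it is an alternating sum over the chains containing `c₀`. -/
theorem sum_chains_of_plHomeomorphic [Fintype P] {d : ℕ}
    (h : PLHomeomorphic (orderComplexCarrier P) (stdPLSphere d)) {c₀ : Finset P}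
    (hne : c₀.Nonempty) (hc₀ : IsChain (· ≤ ·) (c₀ : Set P)) :
    ∑ c ∈ Finset.univ.filter (fun c : Finset P => IsChain (· ≤ ·) (c : Set P) ∧ c₀ ⊆ c),
      (-1 : ℤ) ^ (c.card + 1) =
      (-1) ^ (d + 1) := by
  obtain ⟨f, K, hfin, hKA, haff⟩ := h
  have : Nonempty c₀ := hne.to_subtype
  obtain ⟨x, hx⟩ := openSimplex_nonempty (stdVertices c₀)
  rw [mem_openSimplex_stdVertices] at hx
  obtain ⟨h0, h1, h2⟩ := hx
  have hxA' : x ∈ realization fun c : Finset P => c.Nonempty ∧ IsChain (· ≤ ·) (c : Set P) :=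
    ⟨h0, h1, by rw [h2]; exact ⟨hne, hc₀⟩⟩
  have hxA : x ∈ orderComplexCarrier P := by rw [orderComplexCarrier_eq]; exact hxA'
  have hyB : (f ⟨x, hxA⟩ : Fin (d + 1) → ℝ) ∈
      realization fun c : Finset (Fin (d + 1)) => c.Nonempty ∧ c ≠ Finset.univ := by
    rw [← stdPLSphere_eq]; exact (f ⟨x, hxA⟩).2
  have key := localEuler_eq_of_homeomorph f K hfin hKA haff
    (by rw [orderComplexCarrier_eq]; exact isCellPartition_realization fun c hc => hc.1)
    (by rw [stdPLSphere_eq]; exact isCellPartition_realization fun c hc => hc.1) ⟨x, hxA⟩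
  refine (localEuler_realization (fun c hc => hc.1) hxA' fun c => ?_).symm.trans
    (key.trans ((localEuler_realization (fun c hc => hc.1) hyB fun c => ?_).trans
      (sum_ssubset_univ hyB.2.2.1 hyB.2.2.2)))
  · rw [h2]
    simp only [Finset.mem_filter, Finset.mem_univ, true_and]
    exact ⟨fun h => ⟨⟨hne.mono h.2, h.1⟩, h.2⟩, fun h => ⟨h.1.2, h.2⟩⟩
  · simp only [Finset.mem_filter, Finset.mem_univ, true_and]

end OrderComplex

/-! ### Removing a line from a PL sphere -/

section Lines

variable {V : Type*} [NormedAddCommGroup V] [NormedSpace ℝ V]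

theorem affineSpan_insert_ne_top (hV : 2 < Module.finrank ℝ V) {L : AffineSubspace ℝ V}
    (hL : Module.finrank ℝ L.direction ≤ 1) (a : V) :
    affineSpan ℝ (insert a (L : Set V)) ≠ ⊤ := by
  intro h
  have h1 := finrank_vectorSpan_insert_le L a
  rw [← direction_affineSpan, h, AffineSubspace.direction_top, finrank_top] at h1
  omega

theorem ne_top_of_finrank_le_one (hV : 2 < Module.finrank ℝ V) {L : AffineSubspace ℝ V}
    (hL : Module.finrank ℝ L.direction ≤ 1) : L ≠ ⊤ := by
  rintro rfl
  rw [AffineSubspace.direction_top, finrank_top] at hL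
  omega

variable [FiniteDimensional ℝ V]

theorem exists_mem_forall_notMem {κ : Type*} [Finite κ] (S : κ → AffineSubspace ℝ V)
    (hS : ∀ k, S k ≠ ⊤) {O : Set V} (hO : IsOpen O) (hne : O.Nonempty) :
    ∃ z ∈ O, ∀ k, z ∉ S k := by
  borelize V
  by_contra! h
  have hsub : O ⊆ ⋃ k, (S k : Set V) := fun z hz => Set.mem_iUnion.2 (h z hz)
  have h0 : (MeasureTheory.Measure.addHaar : MeasureTheory.Measure V) (⋃ k, (S k : Set V)) = 0 :=
    MeasureTheory.measure_iUnion_null fun k =>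
      MeasureTheory.Measure.addHaar_affineSubspace _ (S k) (hS k)
  exact (hO.measure_pos _ hne).ne' (MeasureTheory.measure_mono_null hsub h0)

/-- In dimension at least three, a convex open set stays connected when finitely many lines are
removed: two points are joined through a third one that avoids the planes they span with the
lines. -/
theorem isPreconnected_diff_lines (hV : 2 < Module.finrank ℝ V) {κ : Type*} [Finite κ]
    (L : κ → AffineSubspace ℝ V) (hL : ∀ k, Module.finrank ℝ (L k).direction ≤ 1)
    {U : Set V} (hU : IsOpen U) (hU' : Convex ℝ U) :
    IsPreconnected (U \ ⋃ k, (L k : Set V)) := by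
  refine isPreconnected_of_forall_pair fun a ha b hb => ?_
  obtain ⟨z, hzU, hz⟩ := exists_mem_forall_notMem
    (fun k : κ × Bool => affineSpan ℝ (insert (if k.2 then a else b) (L k.1 : Set V)))
    (fun k => affineSpan_insert_ne_top hV (hL k.1) _) hU ⟨a, ha.1⟩
  have key : ∀ c ∈ U \ ⋃ k, (L k : Set V),
      (∀ k, z ∉ affineSpan ℝ (insert c (L k : Set V))) →
      segment ℝ c z ⊆ U \ ⋃ k, (L k : Set V) := by
    intro c hc hcz x hx
    refine ⟨hU'.segment_subset hc.1 hzU hx, fun hxL => ?_⟩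
    obtain ⟨k, hk⟩ := Set.mem_iUnion.1 hxL
    rw [segment_eq_image_lineMap] at hx
    obtain ⟨t, -, rfl⟩ := hx
    have ht : t ≠ 0 := by
      rintro rfl
      rw [AffineMap.lineMap_apply_zero] at hk
      exact hc.2 (Set.mem_iUnion.2 ⟨k, hk⟩)
    refine hcz k ?_
    have h1 : z = AffineMap.lineMap c (AffineMap.lineMap c z t) t⁻¹ := by
      simp [AffineMap.lineMap_apply, smul_smul, ht]
    rw [h1]
    exact AffineMap.lineMap_mem _ (subset_affineSpan ℝ _ (Set.mem_insert _ _))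
      (subset_affineSpan ℝ _ (Set.mem_insert_of_mem _ hk))
  refine ⟨segment ℝ a z ∪ segment ℝ b z, Set.union_subset (key a ha fun k => ?_)
    (key b hb fun k => ?_), Or.inl (left_mem_segment ℝ a z), Or.inr (left_mem_segment ℝ b z), ?_⟩
  · simpa using hz (k, true)
  · simpa using hz (k, false)
  · exact IsPreconnected.union z (right_mem_segment ℝ a z) (right_mem_segment ℝ b z)
      (convex_segment a z).isPreconnected (convex_segment b z).isPreconnected

theorem subset_closure_diff_lines (hV : 2 < Module.finrank ℝ V) {κ : Type*} [Finite κ]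
    (L : κ → AffineSubspace ℝ V) (hL : ∀ k, Module.finrank ℝ (L k).direction ≤ 1)
    {U : Set V} (hU : IsOpen U) : U ⊆ closure (U \ ⋃ k, (L k : Set V)) := by
  intro x hx
  rw [mem_closure_iff]
  intro O hO hxO
  obtain ⟨z, hz, hzL⟩ := exists_mem_forall_notMem L
    (fun k => ne_top_of_finrank_le_one hV (hL k)) (hO.inter hU) ⟨x, hxO, hx⟩
  exact ⟨z, hz.1, hz.2, by simpa using hzL⟩

end Lines

section Chart

variable {n : ℕ}

/-- A linear chart of the open star of the `i`-th vertex of the boundary of the standard simplex: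
the differences of the coordinates other than the `i`-th. -/
def chart (i : Fin (n + 2)) : (Fin (n + 2) → ℝ) →ₗ[ℝ] (Fin n → ℝ) :=
  LinearMap.pi fun k =>
    (LinearMap.proj (R := ℝ) (φ := fun _ : Fin (n + 2) => ℝ) (i.succAbove k.succ)) -
      LinearMap.proj (i.succAbove 0)

/-- The coordinates other than the `i`-th of the point with a given image under `chart i`, up to a
common summand, which is determined by the minimum being zero. -/
def chartCoord (z : Fin n → ℝ) : Fin (n + 1) → ℝ := Fin.cons 0 z

/-- The least of the coordinates of `chartCoord`. -/
noncomputable def chartMin (z : Fin n → ℝ) : ℝ :=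
  Finset.univ.inf' Finset.univ_nonempty (chartCoord z)

/-- The inverse of `chart i`, on the open star of the `i`-th vertex. -/
noncomputable def chartInv (i : Fin (n + 2)) (z : Fin n → ℝ) : Fin (n + 2) → ℝ :=
  i.insertNth (1 - ∑ k, (chartCoord z k - chartMin z)) fun k => chartCoord z k - chartMin z

theorem continuous_chartCoord (k : Fin (n + 1)) :
    Continuous fun z : Fin n → ℝ => chartCoord z k := by
  refine Fin.cases ?_ (fun j => ?_) k
  · simpa [chartCoord] using continuous_const
  · simpa [chartCoord] using continuous_apply j

theorem continuous_chartMin : Continuous (chartMin : (Fin n → ℝ) → ℝ) :=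
  Continuous.finset_inf'_apply _ fun k _ => continuous_chartCoord k

theorem continuous_chartInv (i : Fin (n + 2)) : Continuous (chartInv (n := n) i) := by
  refine continuous_pi fun j => ?_
  rcases Fin.eq_self_or_eq_succAbove i j with rfl | ⟨k, rfl⟩
  · simp only [chartInv, Fin.insertNth_apply_same]
    exact continuous_const.sub (continuous_finsetSum _ fun k _ =>
      (continuous_chartCoord k).sub continuous_chartMin)
  · simp only [chartInv, Fin.insertNth_apply_succAbove]
    exact (continuous_chartCoord k).sub continuous_chartMin

theorem chart_chartInv (i : Fin (n + 2)) (z : Fin n → ℝ) : chart i (chartInv i z) = z := by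
  ext k
  simp [chart, chartInv, chartCoord]

theorem chartInv_mem {i : Fin (n + 2)} {z : Fin n → ℝ} (hz : 0 < chartInv i z i) :
    chartInv i z ∈ CellCx.stdPLSphere (n + 1) := by
  refine ⟨⟨fun j => ?_, ?_⟩, ?_⟩
  · rcases Fin.eq_self_or_eq_succAbove i j with rfl | ⟨k, rfl⟩
    · exact hz.le
    · simp only [chartInv, Fin.insertNth_apply_succAbove]
      exact sub_nonneg.2 (Finset.inf'_le _ (Finset.mem_univ k))
  · rw [Fin.sum_univ_succAbove _ i]
    simp [chartInv]
  · obtain ⟨k, -, hk⟩ := Finset.exists_mem_eq_inf' Finset.univ_nonempty (chartCoord z)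
    refine ⟨i.succAbove k, ?_⟩
    simp only [chartInv, Fin.insertNth_apply_succAbove]
    exact sub_eq_zero.2 hk.symm

theorem chartInv_chart {i : Fin (n + 2)} {y : Fin (n + 2) → ℝ}
    (hy : y ∈ CellCx.stdPLSphere (n + 1)) (hi : 0 < y i) : chartInv i (chart i y) = y := by
  obtain ⟨⟨h0, h1⟩, j, hj⟩ := hy
  have hc : ∀ k, chartCoord (chart i y) k = y (i.succAbove k) - y (i.succAbove 0) := by
    refine Fin.cases ?_ fun k => ?_
    · simp [chartCoord]
    · simp [chartCoord, chart]
  have hm : chartMin (chart i y) = - y (i.succAbove 0) := by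
    apply le_antisymm
    · rcases Fin.eq_self_or_eq_succAbove i j with rfl | ⟨k, rfl⟩
      · exact absurd hj hi.ne'
      · refine (Finset.inf'_le _ (Finset.mem_univ k)).trans ?_
        rw [hc, hj]; simp
    · refine Finset.le_inf' _ _ fun k _ => ?_
      rw [hc]
      have := h0 (i.succAbove k)
      linarith
  have hcm : ∀ k, chartCoord (chart i y) k - chartMin (chart i y) = y (i.succAbove k) := by
    intro k; rw [hc, hm]; ring
  ext l
  rcases Fin.eq_self_or_eq_succAbove i l with rfl | ⟨k, rfl⟩
  · simp only [chartInv, Fin.insertNth_apply_same, hcm]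
    rw [Fin.sum_univ_succAbove _ l] at h1
    linarith
  · simp only [chartInv, Fin.insertNth_apply_succAbove, hcm]

/-- A PL sphere of dimension at least three is not locally separated by a line: in a linear chart,
the part of the sphere on the line is contained in finitely many lines, one for each simplex on
which the PL homeomorphism is affine. -/
theorem exists_nhdsWithin_diff_line_isPreconnected {E : Type*} [AddCommGroup E] [Module ℝ E]
    [TopologicalSpace E] {A : Set E} (hn : 2 < n)
    (h : CellCx.PLHomeomorphic A (CellCx.stdPLSphere (n + 1))) (a b : E) {t : E} (ht : t ∈ A)
    {W : Set E} (hW : IsOpen W) (htW : t ∈ W) :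
    ∃ N ⊆ A ∩ W, N ∈ 𝓝[A] t ∧ (N \ line[ℝ, a, b]).Nonempty ∧
      IsPreconnected (N \ line[ℝ, a, b]) := by
  classical
  obtain ⟨f, K, hfin, hKA, haff⟩ := h
  choose! g hg using haff
  have := hfin.to_subtype
  obtain ⟨i, hi⟩ : ∃ i, 0 < (f ⟨t, ht⟩ : Fin (n + 2) → ℝ) i := by
    by_contra! hle
    have h1 := (f ⟨t, ht⟩).2.1.2
    have h2 : ∑ j, (f ⟨t, ht⟩ : Fin (n + 2) → ℝ) j ≤ 0 := Finset.sum_nonpos fun j _ => hle j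
    linarith
  let D : Set (Fin n → ℝ) := {z | 0 < chartInv i z i}
  have hD : IsOpen D :=
    isOpen_lt continuous_const ((continuous_apply i).comp (continuous_chartInv i))
  let Φ : D → A := fun z => f.symm ⟨chartInv i z, chartInv_mem z.2⟩
  have hΦ : Continuous Φ := f.symm.continuous.comp
    (((continuous_chartInv i).comp continuous_subtype_val).subtype_mk _)
  let Ψ : (Fin n → ℝ) → E := fun z => if hz : z ∈ D then Φ ⟨z, hz⟩ else t
  have hΨΦ : ∀ z (hz : z ∈ D), Ψ z = Φ ⟨z, hz⟩ := fun z hz => dif_pos hz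
  have hΨA : ∀ z ∈ D, Ψ z ∈ A := fun z hz => by rw [hΨΦ z hz]; exact (Φ _).2
  have hfΨ : ∀ z (hz : z ∈ D), (f ⟨Ψ z, hΨA z hz⟩ : Fin (n + 2) → ℝ) = chartInv i z := by
    intro z hz
    have : (⟨Ψ z, hΨA z hz⟩ : A) = Φ ⟨z, hz⟩ := Subtype.ext (hΨΦ z hz)
    rw [this]
    simp [Φ]
  have hcD : ∀ x : A, 0 < (f x : Fin (n + 2) → ℝ) i → chart i (f x) ∈ D := fun x hx => by
    change 0 < chartInv i (chart i (f x)) i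
    rw [chartInv_chart (f x).2 hx]; exact hx
  have hΨc : ∀ x : A, 0 < (f x : Fin (n + 2) → ℝ) i → Ψ (chart i (f x)) = x := fun x hx => by
    have h1 := hfΨ _ (hcD x hx)
    rw [chartInv_chart (f x).2 hx] at h1
    exact congrArg Subtype.val (f.injective (Subtype.ext h1))
  have hΨcont : ContinuousOn Ψ D := by
    rw [continuousOn_iff_continuous_domRestrict]
    have : D.domRestrict Ψ = fun z => (Φ z : E) := by
      funext z; exact hΨΦ z z.2
    rw [this]
    exact continuous_subtype_val.comp hΦ
  obtain ⟨ε, hε, hball⟩ := Metric.isOpen_iff.1 (hΨcont.isOpen_inter_preimage hD hW)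
    (chart i (f ⟨t, ht⟩)) ⟨hcD _ hi, by rw [Set.mem_preimage, hΨc ⟨t, ht⟩ hi]; exact htW⟩
  set β := Metric.ball (chart i (f ⟨t, ht⟩)) ε with hβ
  let L : K.faces → AffineSubspace ℝ (Fin n → ℝ) := fun s =>
    (line[ℝ, a, b]).map ((chart i).toAffineMap.comp (g s))
  have hL : ∀ s, Module.finrank ℝ (L s).direction ≤ 1 := by
    intro s
    have h1 : L s = line[ℝ, (chart i).toAffineMap.comp (g s) a,
        (chart i).toAffineMap.comp (g s) b] := by
      simp only [L, AffineSubspace.map_span, Set.image_pair]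
    rw [h1, direction_affineSpan]
    exact (collinear_pair ℝ _ _).finrank_le_one
  have hV : 2 < Module.finrank ℝ (Fin n → ℝ) := by simpa using hn
  have hLine : ∀ z ∈ D, Ψ z ∈ line[ℝ, a, b] → z ∈ ⋃ s, (L s : Set (Fin n → ℝ)) := by
    intro z hz hzl
    obtain ⟨s, hs, hzs⟩ := Geometry.SimplicialComplex.mem_space_iff.1 (hKA ▸ hΨA z hz)
    refine Set.mem_iUnion.2 ⟨⟨s, hs⟩, ?_⟩
    refine (AffineSubspace.mem_map).2 ⟨Ψ z, hzl, ?_⟩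
    have h1 := hg s hs ⟨Ψ z, hΨA z hz⟩ hzs
    rw [hfΨ z hz] at h1
    change chart i (g s (Ψ z)) = z
    rw [← h1, chart_chartInv]
  have hdense := subset_closure_diff_lines hV L hL (U := β) Metric.isOpen_ball
  have hsub : β \ ⋃ s, (L s : Set (Fin n → ℝ)) ⊆ β \ Ψ ⁻¹' line[ℝ, a, b] := fun z hz =>
    ⟨hz.1, fun hzl => hz.2 (hLine z (hball hz.1).1 hzl)⟩
  have hpre : IsPreconnected (β \ Ψ ⁻¹' line[ℝ, a, b]) :=
    (isPreconnected_diff_lines hV L hL Metric.isOpen_ball (convex_ball _ _)).subset_closure hsub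
      (Set.sdiff_subset.trans hdense)
  let N : Set E := Ψ '' β
  have hN : N \ line[ℝ, a, b] = Ψ '' (β \ Ψ ⁻¹' line[ℝ, a, b]) := by
    ext x
    constructor
    · rintro ⟨⟨z, hz, rfl⟩, hx⟩
      exact ⟨z, ⟨hz, hx⟩, rfl⟩
    · rintro ⟨z, ⟨hz, hx⟩, rfl⟩
      exact ⟨⟨z, hz, rfl⟩, hx⟩
  refine ⟨N, ?_, ?_, ?_, ?_⟩
  · rintro _ ⟨z, hz, rfl⟩
    exact ⟨hΨA z (hball hz).1, (hball hz).2⟩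
  · have hcont : Continuous fun x : A => (f x : Fin (n + 2) → ℝ) :=
      continuous_subtype_val.comp f.continuous
    have hopen : IsOpen {x : A | 0 < (f x : Fin (n + 2) → ℝ) i ∧ chart i (f x) ∈ β} :=
      (isOpen_lt continuous_const ((continuous_apply i).comp hcont)).inter
        (Metric.isOpen_ball.preimage ((LinearMap.continuous_of_finiteDimensional _).comp hcont))
    obtain ⟨O, hO, hOe⟩ := isOpen_induced_iff.1 hopen
    refine mem_nhdsWithin.2 ⟨O, hO, ?_, ?_⟩
    · have : (⟨t, ht⟩ : A) ∈ Subtype.val ⁻¹' O := by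
        rw [hOe]; exact ⟨hi, Metric.mem_ball_self hε⟩
      exact this
    · rintro x ⟨hxO, hxA⟩
      have : (⟨x, hxA⟩ : A) ∈ Subtype.val ⁻¹' O := hxO
      rw [hOe] at this
      exact ⟨_, this.2, hΨc ⟨x, hxA⟩ this.1⟩
  · rw [hN]
    have : (β \ ⋃ s, (L s : Set (Fin n → ℝ))).Nonempty := by
      rw [← closure_nonempty_iff]
      exact ⟨_, hdense (Metric.mem_ball_self hε)⟩
    exact (this.mono hsub).image _
  · rw [hN]
    exact hpre.image _ (hΨcont.mono fun z hz => (hball hz.1).1)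

end Chart

end PLEuler

/-! ### Cells and their vertex sets -/

namespace CellCx

universe u

section Cells

variable {X : Type u} [TopologicalSpace X] {C : Set X} [CWComplex C]

theorem Face.dim_lt_dim {α β : Face C} (h : α < β) : α.dim < β.dim :=
  (Face.eq_or_dim_lt h.le).resolve_left h.ne

theorem Face.dim_le_dim {α β : Face C} (h : α ≤ β) : α.dim ≤ β.dim :=
  (Face.eq_or_dim_lt h).elim (fun h => h ▸ le_rfl) le_of_lt

theorem card_nonempty_ssubset {m : ℕ} {t : Finset (Fin m)} (ht : t.Nonempty) :
    Nat.card {s : Finset (Fin m) // s.Nonempty ∧ s ⊂ t} + 2 = 2 ^ t.card := by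
  have h : Nat.card {s : Finset (Fin m) // s.Nonempty ∧ s ⊂ t} = (t.ssubsets.erase ∅).card :=
    Nat.subtype_card _ fun s => by
      rw [Finset.mem_erase, Finset.mem_ssubsets, Finset.nonempty_iff_ne_empty]
  have h2 : ∅ ∈ t.ssubsets := Finset.empty_mem_ssubsets ht
  rw [h, Finset.card_erase_of_mem h2, Finset.ssubsets,
    Finset.card_erase_of_mem (Finset.mem_powerset_self t), Finset.card_powerset]
  have : 2 ≤ 2 ^ t.card := by
    calc 2 = 2 ^ 1 := rfl
      _ ≤ _ := Nat.pow_le_pow_right (by norm_num) ht.card_pos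
  omega

/-- The isomorphism between the proper faces of a cell and the proper faces of a simplex preserves
dimensions: both sides have the same number of faces below a given one. -/
theorem card_orderIso_apply {α : Face C}
    (φ : {β : Face C // β < α} ≃o {s : Finset (Fin (α.dim + 1)) // s.Nonempty ∧ s ≠ Finset.univ})
    {d : ℕ} (hC : IsSimplicialCellComplex C d) (β : {β : Face C // β < α}) :
    (φ β).1.card = β.1.dim + 1 := by
  obtain ⟨ψ⟩ := hC.boundary β.1
  have h1 : Nat.card {γ : Face C // γ < β.1} + 2 = 2 ^ (β.1.dim + 1) := by
    rw [Nat.card_congr ψ.toEquiv]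
    have := card_nonempty_ssubset (m := β.1.dim + 1) Finset.univ_nonempty
    simpa [Finset.ssubset_univ_iff] using this
  have h2 : Nat.card {γ : Face C // γ < β.1} + 2 = 2 ^ (φ β).1.card := by
    rw [← card_nonempty_ssubset (φ β).2.1]
    congr 1
    refine Nat.card_eq_of_bijective (fun γ : {γ : Face C // γ < β.1} =>
      (⟨(φ ⟨γ.1, γ.2.trans β.2⟩).1, (φ _).2.1,
        (φ.lt_iff_lt (x := ⟨γ.1, γ.2.trans β.2⟩) (y := β)).2 γ.2⟩ :
        {s : Finset (Fin (α.dim + 1)) // s.Nonempty ∧ s ⊂ (φ β).1})) ⟨?_, ?_⟩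
    · intro γ γ' h
      have h' : (φ ⟨γ.1, γ.2.trans β.2⟩).1 = (φ ⟨γ'.1, γ'.2.trans β.2⟩).1 :=
        Subtype.mk.inj h
      exact Subtype.ext (congrArg (fun δ => δ.1) (φ.injective (Subtype.ext h')))
    · rintro ⟨s, hs, hsβ⟩
      have hne : s ≠ Finset.univ := fun h => (h ▸ hsβ).not_subset (Finset.subset_univ _)
      obtain ⟨γ, hγ⟩ := φ.surjective ⟨s, hs, hne⟩
      have hγβ : γ < β := φ.lt_iff_lt.1 (by rw [hγ]; exact hsβ)
      have hγ' : (φ γ).1 = s := congrArg Subtype.val hγ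
      exact ⟨⟨γ.1, hγβ⟩, Subtype.ext hγ'⟩
  exact Nat.pow_right_injective le_rfl (h2.symm.trans h1)

section Vert

variable {d n : ℕ} (lab : Fin n ≃ Vertex C)

open Classical in
/-- The set of labels of the vertices of a cell. -/
noncomputable def vert (α : Face C) : Finset (Fin n) :=
  Finset.univ.filter fun i => (lab i).1 ≤ α

variable {lab}

theorem mem_vert {α : Face C} {i : Fin n} : i ∈ vert lab α ↔ (lab i).1 ≤ α := by
  simp [vert]

theorem vert_mono {α β : Face C} (h : α ≤ β) : vert lab α ⊆ vert lab β := fun _ hi =>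
  mem_vert.2 ((mem_vert.1 hi).trans h)

/-- The isomorphism of the boundary of a cell with the boundary of a simplex, rewritten in terms of
an enumeration `e` of the labels of its vertices. -/
theorem exists_orderIso_vert (lab : Fin n ≃ Vertex C) (hC : IsSimplicialCellComplex C d)
    (α : Face C) : ∃ (e : Fin (α.dim + 1) → Fin n)
      (φ : {β : Face C // β < α} ≃o
        {s : Finset (Fin (α.dim + 1)) // s.Nonempty ∧ s ≠ Finset.univ}),
      Function.Injective e ∧ (∀ i, i ∈ vert lab α ↔ i ∈ Set.range e) ∧
      ∀ β j, j ∈ (φ β).1 ↔ e j ∈ vert lab β.1 := by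
  obtain ⟨φ⟩ := hC.boundary α
  have hcard := card_orderIso_apply φ hC
  rcases Nat.eq_zero_or_pos α.dim with h0 | hpos
  · have hsub : Subsingleton (Fin (α.dim + 1)) := by
      rw [h0]; exact inferInstanceAs (Subsingleton (Fin 1))
    refine ⟨fun _ => lab.symm ⟨α, h0⟩, φ, fun _ _ _ => Subsingleton.elim _ _, fun i => ?_,
      fun β => ?_⟩
    · rw [mem_vert]
      constructor
      · intro hi
        refine ⟨0, ?_⟩
        rw [Equiv.symm_apply_eq]
        rcases Face.eq_or_dim_lt hi with h | h
        · exact Subtype.ext h.symm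
        · omega
      · rintro ⟨-, rfl⟩
        simp
    · have := Face.dim_lt_dim β.2
      omega
  · have hsing : ∀ j : Fin (α.dim + 1), ({j} : Finset (Fin (α.dim + 1))).Nonempty ∧
        ({j} : Finset (Fin (α.dim + 1))) ≠ Finset.univ := fun j => by
      refine ⟨Finset.singleton_nonempty j, fun h => ?_⟩
      have := congrArg Finset.card h
      simp at this
      omega
    have hdim : ∀ j, (φ.symm ⟨{j}, hsing j⟩).1.dim = 0 := fun j => by
      have := hcard (φ.symm ⟨{j}, hsing j⟩)
      simpa using this.symm
    let e : Fin (α.dim + 1) → Fin n := fun j => lab.symm ⟨(φ.symm ⟨{j}, hsing j⟩).1, hdim j⟩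
    have hlab : ∀ j, (lab (e j)).1 = (φ.symm ⟨{j}, hsing j⟩).1 := fun j => by simp [e]
    refine ⟨e, φ, fun j j' h => ?_, fun i => ?_, fun β j => ?_⟩
    · have h1 := congrArg (fun i => (lab i).1) h
      simp only [hlab] at h1
      have h2 := φ.symm.injective (Subtype.ext h1)
      simpa using h2
    · rw [mem_vert]
      constructor
      · intro hi
        have hlt : (lab i).1 < α := lt_of_le_of_ne hi fun h => by
          have := (lab i).2
          rw [h] at this
          omega
        have h1 := hcard ⟨(lab i).1, hlt⟩
        rw [(lab i).2, zero_add, Finset.card_eq_one] at h1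
        obtain ⟨j, hj⟩ := h1
        refine ⟨j, ?_⟩
        apply lab.injective
        apply Subtype.ext
        rw [hlab]
        have h2 : φ.symm ⟨{j}, hsing j⟩ = ⟨(lab i).1, hlt⟩ := by
          rw [OrderIso.symm_apply_eq]
          exact Subtype.ext hj.symm
        rw [h2]
      · rintro ⟨j, rfl⟩
        rw [hlab]
        exact (φ.symm _).2.le
    · rw [mem_vert, hlab]
      have h1 := φ.le_iff_le (x := φ.symm ⟨{j}, hsing j⟩) (y := β)
      rw [OrderIso.apply_symm_apply] at h1
      rw [← Finset.singleton_subset_iff]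
      exact h1

theorem card_vert (hC : IsSimplicialCellComplex C d) (α : Face C) :
    (vert lab α).card = α.dim + 1 := by
  obtain ⟨e, -, he, hv, -⟩ := exists_orderIso_vert lab hC α
  have : vert lab α = Finset.univ.image e := by
    ext i; rw [hv]; simp
  rw [this, Finset.card_image_of_injective _ he, Finset.card_univ, Fintype.card_fin]

theorem le_of_vert_subset (hC : IsSimplicialCellComplex C d) {α β γ : Face C}
    (hβ : β ≤ α) (hγ : γ ≤ α) (h : vert lab β ⊆ vert lab γ) : β ≤ γ := by
  obtain ⟨e, φ, he, hv, hφ⟩ := exists_orderIso_vert lab hC α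
  rcases hγ.eq_or_lt with rfl | hγ
  · exact hβ
  have hβ' : β < α := lt_of_le_of_ne hβ fun hβα => by
    subst hβα
    refine (φ ⟨γ, hγ⟩).2.2 (Finset.eq_univ_iff_forall.2 fun j => ?_)
    exact (hφ _ _).2 (h ((hv _).2 ⟨j, rfl⟩))
  refine (φ.le_iff_le (x := ⟨β, hβ'⟩) (y := ⟨γ, hγ⟩)).1 fun j hj => ?_
  exact (hφ _ _).2 (h ((hφ _ _).1 hj))

theorem eq_of_vert_eq (hC : IsSimplicialCellComplex C d) {α β γ : Face C}
    (hβ : β ≤ α) (hγ : γ ≤ α) (h : vert lab β = vert lab γ) : β = γ :=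
  le_antisymm (le_of_vert_subset hC hβ hγ h.le) (le_of_vert_subset hC hγ hβ h.ge)

theorem exists_le_vert_eq (hC : IsSimplicialCellComplex C d) {α : Face C} {S : Finset (Fin n)}
    (hS : S.Nonempty) (hSα : S ⊆ vert lab α) : ∃ β ≤ α, vert lab β = S := by
  classical
  obtain ⟨e, φ, he, hv, hφ⟩ := exists_orderIso_vert lab hC α
  rcases hSα.eq_or_ssubset with rfl | hlt
  · exact ⟨α, le_rfl, rfl⟩
  have hrange : ∀ i ∈ S, ∃ j, e j = i := fun i hi => (hv i).1 (hSα hi)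
  let s : Finset (Fin (α.dim + 1)) := Finset.univ.filter fun j => e j ∈ S
  have hs : s.Nonempty := by
    obtain ⟨i, hi⟩ := hS
    obtain ⟨j, rfl⟩ := hrange i hi
    exact ⟨j, by simpa [s] using hi⟩
  have hs' : s ≠ Finset.univ := fun h => hlt.not_subset fun i hi => by
    obtain ⟨j, rfl⟩ := (hv i).1 hi
    have : j ∈ s := h ▸ Finset.mem_univ j
    simpa [s] using this
  refine ⟨(φ.symm ⟨s, hs, hs'⟩).1, (φ.symm ⟨s, hs, hs'⟩).2.le, ?_⟩
  have key : ∀ j, e j ∈ vert lab (φ.symm ⟨s, hs, hs'⟩).1 ↔ e j ∈ S := fun j => by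
    rw [← hφ, OrderIso.apply_symm_apply]
    simp [s]
  ext i
  constructor
  · intro hi
    obtain ⟨j, rfl⟩ := (hv i).1 (vert_mono (φ.symm ⟨s, hs, hs'⟩).2.le hi)
    exact (key j).1 hi
  · intro hi
    obtain ⟨j, rfl⟩ := hrange i hi
    exact (key j).2 hi

theorem vert_ssubset (hC : IsSimplicialCellComplex C d) {α β : Face C} (h : α < β) :
    vert lab α ⊂ vert lab β := by
  refine (vert_mono h.le).ssubset_of_ne fun he => ?_
  exact h.ne (eq_of_vert_eq hC h.le le_rfl he)

end Vert

end Cells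

/-! ### The Euler relation for the cells above a given cell -/

section Chains

variable {P : Type*} [PartialOrder P]

open Classical in
/-- Signed count of the chains in a finset of a poset. -/
noncomputable def chainSum (U : Finset P) : ℤ :=
  ∑ c ∈ U.powerset, if IsChain (· ≤ ·) (c : Set P) then (-1) ^ c.card else 0

open Classical in
/-- Removing a maximal element `α` of `U` removes the chains that contain `α`, which correspond to
the chains of elements of `U` below `α`. -/
theorem chainSum_insert {U : Finset P} {α : P} (hα : α ∉ U) (hmax : ∀ β ∈ U, ¬ α < β) :
    chainSum (insert α U) = chainSum U - chainSum (U.filter (· < α)) := by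
  unfold chainSum
  rw [Finset.sum_powerset_insert hα, sub_eq_add_neg, ← Finset.sum_neg_distrib]
  congr 1
  rw [← Finset.sum_subset (Finset.powerset_mono.2 (Finset.filter_subset (· < α) U))]
  · refine Finset.sum_congr rfl fun c hc => ?_
    have hc' := Finset.mem_powerset.1 hc
    have hαc : α ∉ c := fun h => hα (Finset.filter_subset _ _ (hc' h))
    have hiff : IsChain (· ≤ ·) ((insert α c : Finset P) : Set P) ↔
        IsChain (· ≤ ·) (c : Set P) := by
      rw [Finset.coe_insert]
      refine ⟨fun h => h.mono (Set.subset_insert _ _), fun h => h.insert fun b hb _ => ?_⟩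
      exact Or.inr (Finset.mem_filter.1 (hc' hb)).2.le
    rw [Finset.card_insert_of_notMem hαc]
    by_cases h : IsChain (· ≤ ·) (c : Set P)
    · rw [if_pos (hiff.2 h), if_pos h, pow_succ]; ring
    · rw [if_neg (fun h' => h (hiff.1 h')), if_neg h, neg_zero]
  · intro c hc hc'
    refine if_neg fun h => hc' (Finset.mem_powerset.2 fun β hβ => ?_)
    have hβU := Finset.mem_powerset.1 hc hβ
    have hne : β ≠ α := fun h => hα (h ▸ hβU)
    refine Finset.mem_filter.2 ⟨hβU, ?_⟩
    have hcmp := h (Finset.mem_coe.2 (Finset.mem_insert_of_mem hβ))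
      (Finset.mem_coe.2 (Finset.mem_insert_self α c)) hne
    rcases hcmp with h1 | h1
    · exact lt_of_le_of_ne h1 hne
    · exact absurd (lt_of_le_of_ne h1 hne.symm) (hmax β hβU)

open Classical in
/-- If the alternating sum of the elements of every interval `[ρ, α]` with `ρ < α` is zero, then
the signed count of chains above `ρ` is an alternating sum of elements. -/
theorem chainSum_mul_eq [Fintype P] (r : P → ℕ) (ρ : P)
    (hr : ∀ α, ρ < α → ∑ β with ρ ≤ β ∧ β ≤ α, (-1 : ℤ) ^ r β = 0) :
    ∀ (k : ℕ) (U : Finset P), U.card = k → (∀ α ∈ U, ρ < α) →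
      (∀ α ∈ U, ∀ β, ρ < β → β < α → β ∈ U) →
      chainSum U * (-1) ^ r ρ = (-1) ^ r ρ + ∑ α ∈ U, (-1 : ℤ) ^ r α := by
  intro k
  induction k using Nat.strong_induction_on with
  | _ k ih =>
    intro U hk hU hlow
    rcases U.eq_empty_or_nonempty with rfl | hne
    · simp [chainSum]
    obtain ⟨α, hαU, hmax⟩ := U.exists_maximal hne
    have hmax' : ∀ β ∈ U, ¬ α < β := fun β hβ h => h.not_ge (hmax hβ h.le)
    have hpos := Finset.card_pos.2 hne
    have hlt : (U.erase α).card < k := by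
      rw [Finset.card_erase_of_mem hαU]; omega
    have h1 := ih _ hlt (U.erase α) rfl (fun β hβ => hU β (Finset.mem_of_mem_erase hβ))
      (fun β hβ γ h h' => Finset.mem_erase.2 ⟨fun hγ =>
        hmax' β (Finset.mem_of_mem_erase hβ) (hγ ▸ h'),
        hlow β (Finset.mem_of_mem_erase hβ) γ h h'⟩)
    have hlt2 : ((U.erase α).filter (· < α)).card < k :=
      (Finset.card_le_card (Finset.filter_subset _ _)).trans_lt hlt
    have h2 := ih _ hlt2 ((U.erase α).filter (· < α)) rfl
      (fun β hβ => hU β (Finset.mem_of_mem_erase (Finset.filter_subset _ _ hβ)))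
      (fun β hβ γ h h' => by
        obtain ⟨hβ1, hβ2⟩ := Finset.mem_filter.1 hβ
        have hγα := h'.trans hβ2
        exact Finset.mem_filter.2 ⟨Finset.mem_erase.2 ⟨hγα.ne,
          hlow β (Finset.mem_of_mem_erase hβ1) γ h h'⟩, hγα⟩)
    have h3 : (-1 : ℤ) ^ r ρ + ∑ β ∈ (U.erase α).filter (· < α), (-1 : ℤ) ^ r β +
        (-1) ^ r α = 0 := by
      rw [← hr α (hU α hαU)]
      have : Finset.univ.filter (fun β => ρ ≤ β ∧ β ≤ α) =
          insert ρ (insert α ((U.erase α).filter (· < α))) := by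
        ext β
        simp only [Finset.mem_filter, Finset.mem_univ, true_and, Finset.mem_insert,
          Finset.mem_erase]
        constructor
        · rintro ⟨h, h'⟩
          rcases h.eq_or_lt with rfl | h
          · exact Or.inl rfl
          rcases h'.eq_or_lt with rfl | h'
          · exact Or.inr (Or.inl rfl)
          exact Or.inr (Or.inr ⟨⟨h'.ne, hlow α hαU β h h'⟩, h'⟩)
        · rintro (rfl | rfl | ⟨⟨-, h⟩, h'⟩)
          · exact ⟨le_rfl, (hU α hαU).le⟩
          · exact ⟨(hU _ hαU).le, le_rfl⟩
          · exact ⟨(hU β h).le, h'.le⟩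
      rw [this, Finset.sum_insert, Finset.sum_insert]
      · ring
      · simp
      · simp only [Finset.mem_insert, Finset.mem_filter, Finset.mem_erase, not_or]
        exact ⟨(hU α hαU).ne, fun h => (hU ρ h.1.2).false⟩
    have hins : insert α (U.erase α) = U := Finset.insert_erase hαU
    have h4 := chainSum_insert (Finset.notMem_erase α U)
      (fun β hβ => hmax' β (Finset.mem_of_mem_erase hβ))
    rw [hins] at h4
    rw [h4, sub_mul, h1, h2, ← Finset.add_sum_erase U _ hαU]
    linarith

open Classical in
/-- The chains containing a chain `c₀` with greatest element `ρ` that is saturated below `ρ` arise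
from `c₀` by adding a chain of elements greater than `ρ`. -/
theorem sum_chains_superset [Fintype P] {c₀ : Finset P} {ρ : P}
    (hc₀ : IsChain (· ≤ ·) (c₀ : Set P)) (hρ : ρ ∈ c₀) (hle : ∀ σ ∈ c₀, σ ≤ ρ)
    (hsat : ∀ σ < ρ, (∀ τ ∈ c₀, σ ≤ τ ∨ τ ≤ σ) → σ ∈ c₀) :
    ∑ c ∈ Finset.univ.filter (fun c : Finset P => IsChain (· ≤ ·) (c : Set P) ∧ c₀ ⊆ c),
      (-1 : ℤ) ^ (c.card + 1) =
    (-1) ^ (c₀.card + 1) * chainSum (Finset.univ.filter (ρ < ·)) := by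
  unfold chainSum
  rw [← Finset.sum_filter, Finset.mul_sum]
  refine Finset.sum_nbij' (fun c => c \ c₀) (fun c => c₀ ∪ c) ?_ ?_ ?_ ?_ ?_
  · intro c hc
    obtain ⟨hc1, hc2⟩ := (Finset.mem_filter.1 hc).2
    refine Finset.mem_filter.2 ⟨Finset.mem_powerset.2 fun σ hσ => ?_, hc1.mono ?_⟩
    · obtain ⟨hσ1, hσ2⟩ := Finset.mem_sdiff.1 hσ
      refine Finset.mem_filter.2 ⟨Finset.mem_univ _, ?_⟩
      have hne : σ ≠ ρ := fun h => hσ2 (h ▸ hρ)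
      rcases hc1.total (Finset.mem_coe.2 hσ1) (Finset.mem_coe.2 (hc2 hρ)) with h | h
      · exact absurd (hsat σ (lt_of_le_of_ne h hne) fun τ hτ =>
          hc1.total (Finset.mem_coe.2 hσ1) (Finset.mem_coe.2 (hc2 hτ))) hσ2
      · exact lt_of_le_of_ne h hne.symm
    · exact Finset.coe_subset.2 Finset.sdiff_subset
  · intro c hc
    obtain ⟨hc1, hc2⟩ := Finset.mem_filter.1 hc
    refine Finset.mem_filter.2 ⟨Finset.mem_univ _, ?_, Finset.subset_union_left⟩
    have hgt : ∀ τ ∈ c, ρ < τ := fun τ hτ =>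
      (Finset.mem_filter.1 (Finset.mem_powerset.1 hc1 hτ)).2
    intro a ha b hb hab
    rw [Finset.mem_coe, Finset.mem_union] at ha hb
    rcases ha with ha | ha <;> rcases hb with hb | hb
    · exact hc₀ ha hb hab
    · exact Or.inl ((hle a ha).trans (hgt b hb).le)
    · exact Or.inr ((hle b hb).trans (hgt a ha).le)
    · exact hc2 ha hb hab
  · intro c hc
    exact Finset.union_sdiff_of_subset (Finset.mem_filter.1 hc).2.2
  · intro c hc
    rw [Finset.union_sdiff_left]
    refine Finset.sdiff_eq_self_of_disjoint (Finset.disjoint_left.2 fun σ hσ hσ' => ?_)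
    have := (Finset.mem_filter.1 (Finset.mem_powerset.1 (Finset.mem_filter.1 hc).1 hσ)).2
    exact this.not_ge (hle σ hσ')
  · intro c hc
    have hsub := (Finset.mem_filter.1 hc).2.2
    rw [← pow_add]
    congr 1
    have := Finset.card_sdiff_add_card_eq_card hsub
    omega

end Chains

section Link

variable {X : Type u} [TopologicalSpace X] {C : Set X} [CWComplex C]
variable {d n : ℕ} {lab : Fin n ≃ Vertex C}

open Classical in
/-- The cells between `ρ` and `α` correspond to the sets of vertices between `vert ρ` and
`vert α`. -/
theorem sum_interval_eq_zero (hC : IsSimplicialCellComplex C d) (lab : Fin n ≃ Vertex C)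
    {v : Vertex C} [Fintype {α : Face C // v.1 < α}] {ρ α : {α : Face C // v.1 < α}}
    (hlt : ρ < α) :
    ∑ β with ρ ≤ β ∧ β ≤ α, (-1 : ℤ) ^ β.1.dim = 0 := by
  have hss := vert_ssubset (lab := lab) hC (show ρ.1 < α.1 from hlt)
  have h1 : ∑ s ∈ (vert lab α.1 \ vert lab ρ.1).powerset,
      (-1 : ℤ) ^ (vert lab ρ.1).card * (-1) ^ s.card = 0 := by
    rw [← Finset.mul_sum, Finset.sum_powerset_neg_one_pow_card_of_nonempty, mul_zero]
    exact Finset.sdiff_nonempty.2 hss.not_subset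
  have h2 : ∑ β with ρ ≤ β ∧ β ≤ α, (-1 : ℤ) ^ (β.1.dim + 1) = 0 := by
    rw [← h1]
    refine Finset.sum_bij (fun β _ => vert lab β.1 \ vert lab ρ.1) ?_ ?_ ?_ ?_
    · intro β hβ
      obtain ⟨h, h'⟩ := (Finset.mem_filter.1 hβ).2
      exact Finset.mem_powerset.2 (Finset.sdiff_subset_sdiff (vert_mono h') le_rfl)
    · intro β hβ γ hγ h
      obtain ⟨hβ1, hβ2⟩ := (Finset.mem_filter.1 hβ).2
      obtain ⟨hγ1, hγ2⟩ := (Finset.mem_filter.1 hγ).2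
      refine Subtype.ext (eq_of_vert_eq (lab := lab) hC (α := α.1) hβ2 hγ2 ?_)
      have hb := Finset.union_sdiff_of_subset (vert_mono (lab := lab) (show ρ.1 ≤ β.1 from hβ1))
      have hc := Finset.union_sdiff_of_subset (vert_mono (lab := lab) (show ρ.1 ≤ γ.1 from hγ1))
      rw [← hb, ← hc, h]
    · intro s hs
      have hsub : vert lab ρ.1 ∪ s ⊆ vert lab α.1 := Finset.union_subset hss.subset
        ((Finset.mem_powerset.1 hs).trans Finset.sdiff_subset)
      obtain ⟨β, hβα, hβ⟩ := exists_le_vert_eq hC (α := α.1) (S := vert lab ρ.1 ∪ s)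
        ((Finset.card_pos.1 (by rw [card_vert hC]; omega)).mono Finset.subset_union_left) hsub
      have hρβ : ρ.1 ≤ β := le_of_vert_subset (lab := lab) hC hlt.le hβα
        (by rw [hβ]; exact Finset.subset_union_left)
      refine ⟨⟨β, ρ.2.trans_le hρβ⟩, Finset.mem_filter.2 ⟨Finset.mem_univ _, hρβ, hβα⟩, ?_⟩
      simp only [hβ]
      rw [Finset.union_sdiff_left]
      refine Finset.sdiff_eq_self_of_disjoint (Finset.disjoint_left.2 fun i hi => ?_)
      exact (Finset.mem_sdiff.1 (Finset.mem_powerset.1 hs hi)).2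
    · intro β hβ
      have hsub := vert_mono (lab := lab) (show ρ.1 ≤ β.1 from (Finset.mem_filter.1 hβ).2.1)
      rw [← pow_add, ← card_vert (lab := lab) hC]
      congr 1
      have := Finset.card_sdiff_add_card_eq_card hsub
      omega
  simp only [pow_succ, mul_neg_one, Finset.sum_neg_distrib, neg_eq_zero] at h2
  exact h2

/-- Every cell is the greatest element of a chain of cells of dimensions `1, …, dim ρ`, all of
which contain a given vertex `v` of the cell. -/
theorem exists_saturated_chain (hC : IsSimplicialCellComplex C d) (lab : Fin n ≃ Vertex C)
    {v : Vertex C} : ∀ (k : ℕ) (ρ : {α : Face C // v.1 < α}), ρ.1.dim = k →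
      ∃ c : Finset {α : Face C // v.1 < α}, IsChain (· ≤ ·) (c : Set {α : Face C // v.1 < α}) ∧
        ρ ∈ c ∧ (∀ σ ∈ c, σ ≤ ρ) ∧ c.card = k := by
  classical
  intro k
  induction k with
  | zero =>
    intro ρ hρ
    have := Face.dim_lt_dim ρ.2
    omega
  | succ k ih =>
    intro ρ hρ
    rcases Nat.eq_zero_or_pos k with rfl | hk
    · exact ⟨{ρ}, by simp, by simp, by simp, by simp⟩
    have hcard := card_vert (lab := lab) hC ρ.1
    have hv : lab.symm v ∈ vert lab ρ.1 := by
      rw [mem_vert, Equiv.apply_symm_apply]; exact ρ.2.le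
    obtain ⟨i, hi, hiv⟩ := Finset.exists_mem_ne (show 1 < (vert lab ρ.1).card by omega)
      (lab.symm v)
    have hvi : lab.symm v ∈ (vert lab ρ.1).erase i := Finset.mem_erase.2 ⟨hiv.symm, hv⟩
    obtain ⟨β, hβρ, hβ⟩ := exists_le_vert_eq hC (α := ρ.1) (S := (vert lab ρ.1).erase i)
      ⟨_, hvi⟩ (Finset.erase_subset _ _)
    have hβdim : β.dim = k := by
      have := card_vert (lab := lab) hC β
      rw [hβ, Finset.card_erase_of_mem hi] at this
      omega
    have hvβ : v.1 < β := by
      have h1 : v.1 ≤ β := by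
        have h2 : lab.symm v ∈ vert lab β := by rw [hβ]; exact hvi
        rw [mem_vert, Equiv.apply_symm_apply] at h2
        exact h2
      refine lt_of_le_of_ne h1 fun h => ?_
      have := v.2
      rw [h] at this
      omega
    obtain ⟨c, hc, hβc, hle, hck⟩ := ih ⟨β, hvβ⟩ hβdim
    have hρc : ∀ σ ∈ c, σ < ρ := fun σ hσ => by
      refine lt_of_le_of_ne ((hle σ hσ).trans hβρ) fun h => ?_
      have h1 : σ.1.dim ≤ β.dim := Face.dim_le_dim (hle σ hσ)
      rw [h] at h1
      omega
    refine ⟨insert ρ c, ?_, Finset.mem_insert_self _ _, ?_, ?_⟩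
    · rw [Finset.coe_insert]
      exact hc.insert fun σ hσ _ => Or.inr (hρc σ hσ).le
    · intro σ hσ
      rcases Finset.mem_insert.1 hσ with rfl | hσ
      · exact le_rfl
      · exact (hρc σ hσ).le
    · rw [Finset.card_insert_of_notMem fun h => (hρc ρ h).false, hck]

open Classical in
/-- The Euler relation at a cell `ρ` of positive dimension in a pseudotriangulated closed manifold:
it is the local Euler characteristic of the vertex figure of a vertex `v < ρ` at a point in the
interior of the simplex spanned by a saturated chain of cells between `v` and `ρ`. -/
theorem sum_neg_one_pow_dim (hC : IsPseudotriangulation C d) (lab : Fin n ≃ Vertex C)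
    [Fintype (Face C)] {ρ : Face C} (hρ : 0 < ρ.dim) :
    ∑ α with ρ ≤ α, (-1 : ℤ) ^ α.dim = (-1) ^ d := by
  have hS := hC.isSimplicialCellComplex
  obtain ⟨i, hi⟩ : (vert lab ρ).Nonempty := Finset.card_pos.1 (by rw [card_vert hS]; omega)
  set v := lab i
  have hv : v.1 < ρ := lt_of_le_of_ne (mem_vert.1 hi) fun h => by
    have := v.2
    rw [h] at this
    omega
  let ρ' : {α : Face C // v.1 < α} := ⟨ρ, hv⟩
  obtain ⟨c₀, hc₀, hρc, hle, hcard⟩ := exists_saturated_chain hS lab ρ.dim ρ' rfl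
  have hdim : ∀ σ τ : {α : Face C // v.1 < α}, σ ≤ τ ∨ τ ≤ σ → σ.1.dim = τ.1.dim → σ = τ := by
    intro σ τ h hd
    by_contra hne
    rcases h with h | h
    · exact (Face.dim_lt_dim (show σ.1 < τ.1 from lt_of_le_of_ne h fun he =>
        hne (Subtype.ext he))).ne hd
    · exact (Face.dim_lt_dim (show τ.1 < σ.1 from lt_of_le_of_ne h fun he =>
        hne (Subtype.ext he.symm))).ne hd.symm
  have hpos : ∀ σ : {α : Face C // v.1 < α}, 0 < σ.1.dim := fun σ =>
    (Nat.zero_le _).trans_lt (Face.dim_lt_dim σ.2)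
  have hsat : ∀ σ < ρ', (∀ τ ∈ c₀, σ ≤ τ ∨ τ ≤ σ) → σ ∈ c₀ := by
    intro σ hσ hcmp
    have himg : c₀.image (fun τ => τ.1.dim) = Finset.Icc 1 ρ.dim := by
      apply Finset.eq_of_subset_of_card_le
      · intro k hk
        obtain ⟨τ, hτ, rfl⟩ := Finset.mem_image.1 hk
        exact Finset.mem_Icc.2 ⟨hpos τ, Face.dim_le_dim (hle τ hτ)⟩
      · rw [Finset.card_image_of_injOn, hcard]
        · simp
        · intro τ hτ τ' hτ' h
          exact hdim τ τ' (hc₀.total hτ hτ') h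
    have hmem : σ.1.dim ∈ c₀.image (fun τ => τ.1.dim) := by
      rw [himg]
      exact Finset.mem_Icc.2 ⟨hpos σ, Face.dim_le_dim hσ.le⟩
    obtain ⟨τ, hτ, hτσ⟩ := Finset.mem_image.1 hmem
    rw [hdim σ τ (hcmp τ hτ) hτσ.symm]
    exact hτ
  have key := PLEuler.sum_chains_of_plHomeomorphic (hC.vertexFigure v) ⟨ρ', hρc⟩ hc₀
  rw [sum_chains_superset hc₀ hρc hle hsat, hcard] at key
  have h2 := chainSum_mul_eq (fun σ : {α : Face C // v.1 < α} => σ.1.dim) ρ'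
    (fun α hα => sum_interval_eq_zero hS lab hα) _ (Finset.univ.filter (ρ' < ·)) rfl
    (fun α hα => (Finset.mem_filter.1 hα).2)
    (fun α _ β hβ _ => Finset.mem_filter.2 ⟨Finset.mem_univ _, hβ⟩)
  have h3 : ∑ α with ρ ≤ α, (-1 : ℤ) ^ α.dim =
      (-1) ^ ρ.dim + ∑ α ∈ Finset.univ.filter (ρ' < ·), (-1 : ℤ) ^ α.1.dim := by
    have : Finset.univ.filter (ρ ≤ ·) =
        insert ρ ((Finset.univ.filter (ρ' < ·)).map (Function.Embedding.subtype _)) := by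
      ext α
      simp only [Finset.mem_filter, Finset.mem_univ, true_and, Finset.mem_insert, Finset.mem_map,
        Function.Embedding.subtype_apply]
      constructor
      · intro h
        rcases h.eq_or_lt with rfl | h
        · exact Or.inl rfl
        · exact Or.inr ⟨⟨α, hv.trans h⟩, h, rfl⟩
      · rintro (rfl | ⟨σ, hσ, rfl⟩)
        · exact le_rfl
        · exact hσ.le
    rw [this, Finset.sum_insert, Finset.sum_map]
    · rfl
    · simp only [Finset.mem_map, Finset.mem_filter, Finset.mem_univ, true_and,
        Function.Embedding.subtype_apply, not_exists, not_and]
      rintro σ hσ h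
      exact (show ρ < σ.1 from hσ).ne h.symm
  rw [h3]
  refine h2.symm.trans ?_
  have h4 : (-1 : ℤ) ^ (ρ.dim + 1) = -(-1) ^ ρ.dim := by ring
  rw [h4, pow_succ] at key
  change _ * (-1 : ℤ) ^ ρ.dim = _
  linarith

end Link

/-! ### Counting cells in four dimensions -/

section Counting

variable {X : Type u} [TopologicalSpace X] {C : Set X} [CWComplex C]
variable {lab : Fin 5 ≃ Vertex C}

theorem vert_facet (hC : IsSimplicialCellComplex C 4) {F : Face C} (hF : F.dim = 4) :
    vert lab F = Finset.univ := by
  rw [← Finset.card_eq_iff_eq_univ, card_vert hC, hF, Fintype.card_fin]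

/-- The number of cells with a given vertex set. -/
noncomputable def cellCount (lab : Fin 5 ≃ Vertex C) (S : Finset (Fin 5)) : ℕ :=
  Nat.card {τ : Face C // vert lab τ = S}

/-- In a simple complex there is only one edge with given end points, so that every cell containing
the end points contains the edge. -/
theorem le_of_simple (hC : IsSimplicialCellComplex C 4) (hs : IsSimple C) {e α : Face C}
    (he : e.dim = 1) (h : vert lab e ⊆ vert lab α) : e ≤ α := by
  classical
  have hcard := card_vert (lab := lab) hC e
  obtain ⟨e', he'α, he'⟩ := exists_le_vert_eq hC (lab := lab) (α := α) (S := vert lab e)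
    (Finset.card_pos.1 (by omega)) h
  have hdim : e'.dim = 1 := by
    have := card_vert (lab := lab) hC e'
    rw [he', hcard] at this
    omega
  have : e = e' := by
    refine hs ((vert lab e).map lab.toEmbedding) (by rw [Finset.card_map, hcard, he]) e e' he hdim
      ?_ ?_
    · intro v hv
      obtain ⟨i, hi, rfl⟩ := Finset.mem_map.1 hv
      exact mem_vert.1 hi
    · intro v hv
      obtain ⟨i, hi, rfl⟩ := Finset.mem_map.1 hv
      rw [← he'] at hi
      exact mem_vert.1 hi
  rw [this]
  exact he'α

theorem mem_pair_compl_of_card_three {i j k : Fin 5} {S : Finset (Fin 5)} (hS : S.card = 3)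
    (h : ({i, j, k} : Finset (Fin 5))ᶜ ⊆ S) :
    S = {i, j}ᶜ ∨ S = {i, k}ᶜ ∨ S = {j, k}ᶜ := by
  have hc : Sᶜ.card = 2 := by rw [Finset.card_compl, hS, Fintype.card_fin]
  obtain ⟨x, y, hxy, hS'⟩ := Finset.card_eq_two.1 hc
  have hsub : ({x, y} : Finset (Fin 5)) ⊆ {i, j, k} := by
    rw [← hS']
    intro x hx
    by_contra hx'
    exact (Finset.mem_compl.1 hx) (h (Finset.mem_compl.2 hx'))
  have hx := hsub (Finset.mem_insert_self x {y})
  have hy := hsub (Finset.mem_insert_of_mem (Finset.mem_singleton_self y))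
  simp only [Finset.mem_insert, Finset.mem_singleton] at hx hy
  have key : ∀ T, Sᶜ = T → S = Tᶜ := fun T hT => by rw [← hT, compl_compl]
  rcases hx with rfl | rfl | rfl <;> rcases hy with rfl | rfl | rfl
  · exact absurd rfl hxy
  · exact Or.inl (key _ hS')
  · exact Or.inr (Or.inl (key _ hS'))
  · exact Or.inl (key _ (by rw [hS', Finset.pair_comm]))
  · exact absurd rfl hxy
  · exact Or.inr (Or.inr (key _ hS'))
  · exact Or.inr (Or.inl (key _ (by rw [hS', Finset.pair_comm])))
  · exact Or.inr (Or.inr (key _ (by rw [hS', Finset.pair_comm])))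
  · exact absurd rfl hxy

theorem compl_pairs_ne {i j k : Fin 5} (hij : i ≠ j) (hik : i ≠ k) (hjk : j ≠ k) :
    ({i, j}ᶜ : Finset (Fin 5)) ≠ {i, k}ᶜ ∧ ({i, j}ᶜ : Finset (Fin 5)) ≠ {j, k}ᶜ ∧
      ({i, k}ᶜ : Finset (Fin 5)) ≠ {j, k}ᶜ := by
  revert i j k
  decide

variable [Fintype (Face C)]

open Classical in
/-- The finset of `k`-cells containing a given cell. -/
noncomputable def cellsAbove (ρ : Face C) (k : ℕ) : Finset (Face C) :=
  Finset.univ.filter fun α => ρ ≤ α ∧ α.dim = k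

theorem mem_cellsAbove {ρ α : Face C} {k : ℕ} : α ∈ cellsAbove ρ k ↔ ρ ≤ α ∧ α.dim = k := by
  simp [cellsAbove]

theorem card_cellsAbove_of_lt {ρ : Face C} {k : ℕ} (h : k < ρ.dim) :
    (cellsAbove ρ k).card = 0 := by
  rw [Finset.card_eq_zero, Finset.eq_empty_iff_forall_notMem]
  intro α hα
  obtain ⟨h1, rfl⟩ := mem_cellsAbove.1 hα
  exact h.not_ge (Face.dim_le_dim h1)

theorem card_cellsAbove_self (ρ : Face C) : (cellsAbove ρ ρ.dim).card = 1 := by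
  rw [Finset.card_eq_one]
  refine ⟨ρ, Finset.eq_singleton_iff_unique_mem.2 ⟨mem_cellsAbove.2 ⟨le_rfl, rfl⟩, ?_⟩⟩
  intro α hα
  obtain ⟨h1, h2⟩ := mem_cellsAbove.1 hα
  rcases Face.eq_or_dim_lt h1 with h | h
  · exact h.symm
  · omega

/-- The Euler relation, sorted by dimension. -/
theorem euler_relation (hC : IsPseudotriangulation C 4) (lab : Fin 5 ≃ Vertex C) {ρ : Face C}
    (hρ : 0 < ρ.dim) :
    ((cellsAbove ρ 2).card : ℤ) + (cellsAbove ρ 4).card =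
      1 + (cellsAbove ρ 1).card + (cellsAbove ρ 3).card := by
  classical
  have h := sum_neg_one_pow_dim hC lab hρ
  rw [← Finset.sum_fiberwise_of_maps_to (t := Finset.range 5) (g := fun α => α.dim)
    (fun α _ => Finset.mem_range.2 (Nat.lt_succ_of_le (hC.isSimplicialCellComplex.dim_le α)))] at h
  have h2 : ∀ k, ∑ α ∈ (Finset.univ.filter (ρ ≤ ·)).filter (fun α => α.dim = k),
      (-1 : ℤ) ^ α.dim = (cellsAbove ρ k).card * (-1) ^ k := by
    intro k
    have h3 : (Finset.univ.filter (ρ ≤ ·)).filter (fun α => α.dim = k) = cellsAbove ρ k := by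
      ext α; simp [mem_cellsAbove]
    rw [h3, Finset.sum_congr rfl (g := fun _ => (-1 : ℤ) ^ k)
      (fun α hα => by rw [(mem_cellsAbove.1 hα).2])]
    simp
  simp only [h2, Finset.sum_range_succ, Finset.sum_range_zero,
    card_cellsAbove_of_lt hρ] at h
  norm_num at h
  linarith

/-- Every `3`-cell lies in exactly two facets. -/
theorem card_facets_above_ridge (hC : IsPseudotriangulation C 4) (lab : Fin 5 ≃ Vertex C)
    {ρ : Face C} (hρ : ρ.dim = 3) : (cellsAbove ρ 4).card = 2 := by
  have h := euler_relation hC lab (ρ := ρ) (by omega)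
  have h3 := card_cellsAbove_self ρ
  rw [hρ] at h3
  rw [card_cellsAbove_of_lt (by omega), card_cellsAbove_of_lt (k := 1) (by omega), h3] at h
  norm_num at h
  exact_mod_cast h

/-- Double counting: each `3`-cell above an edge `e` lies in two facets, and each facet above `e`
contains three `3`-cells above `e`. -/
theorem two_mul_card_ridges (hC : IsPseudotriangulation C 4) (lab : Fin 5 ≃ Vertex C)
    {e : Face C} (he : e.dim = 1) :
    (cellsAbove e 3).card * 2 = (cellsAbove e 4).card * 3 := by
  classical
  have hS := hC.isSimplicialCellComplex
  refine Finset.card_mul_eq_card_mul (· ≤ ·) (fun ρ hρ => ?_) (fun F hF => ?_)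
  · obtain ⟨h1, h2⟩ := mem_cellsAbove.1 hρ
    rw [← card_facets_above_ridge hC lab h2]
    congr 1
    ext F
    simp only [Finset.mem_bipartiteAbove, mem_cellsAbove]
    exact ⟨fun h => ⟨h.2, h.1.2⟩, fun h => ⟨⟨h1.trans h.1, h.2⟩, h.1⟩⟩
  · obtain ⟨h1, h2⟩ := mem_cellsAbove.1 hF
    have hinj : Set.InjOn (vert lab)
        ((cellsAbove e 3).bipartiteBelow (· ≤ ·) F : Finset (Face C)) := by
      intro ρ hρ ρ' hρ' h
      exact eq_of_vert_eq hS ((Finset.mem_bipartiteBelow _).1 hρ).2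
        ((Finset.mem_bipartiteBelow _).1 hρ').2 h
    have himg : ((cellsAbove e 3).bipartiteBelow (· ≤ ·) F).image (vert lab) =
        (vert lab e)ᶜ.image fun c => {c}ᶜ := by
      ext S
      simp only [Finset.mem_image, Finset.mem_bipartiteBelow, mem_cellsAbove]
      constructor
      · rintro ⟨ρ, ⟨⟨hρ1, hρ2⟩, hρ3⟩, rfl⟩
        have hc : (vert lab ρ)ᶜ.card = 1 := by
          rw [Finset.card_compl, card_vert hS, hρ2, Fintype.card_fin]
        obtain ⟨c, hc⟩ := Finset.card_eq_one.1 hc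
        refine ⟨c, ?_, by rw [← hc, compl_compl]⟩
        have : c ∈ (vert lab ρ)ᶜ := by rw [hc]; simp
        exact Finset.compl_subset_compl.2 (vert_mono hρ1) this
      · rintro ⟨c, hc, rfl⟩
        have hcard : ({c}ᶜ : Finset (Fin 5)).card = 4 := by
          rw [Finset.card_compl, Finset.card_singleton, Fintype.card_fin]
        obtain ⟨ρ, hρF, hρ⟩ := exists_le_vert_eq hS (lab := lab) (α := F) (S := {c}ᶜ)
          (Finset.card_pos.1 (by omega)) (by rw [vert_facet hS h2]; exact Finset.subset_univ _)
        refine ⟨ρ, ⟨⟨le_of_vert_subset (lab := lab) hS h1 hρF ?_, ?_⟩, hρF⟩, hρ⟩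
        · rw [hρ]
          intro i hi
          rw [Finset.mem_compl, Finset.mem_singleton]
          rintro rfl
          exact (Finset.mem_compl.1 hc) hi
        · have := card_vert (lab := lab) hS ρ
          rw [hρ, hcard] at this
          omega
    rw [← Finset.card_image_of_injOn hinj, himg, Finset.card_image_of_injective,
      Finset.card_compl, card_vert hS, he, Fintype.card_fin]
    intro c c' h
    simpa using h

/-- The link of the edge opposite to the triangle `ijk` is a sphere with as many vertices as there
are `2`-cells with vertex set complementary to `ij`, `ik` or `jk`, and with `f₄` faces, all of them
triangles. -/
theorem two_mul_sum_cellCount (hC : IsPseudotriangulation C 4) (hs : IsSimple C)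
    (lab : Fin 5 ≃ Vertex C) {i j k : Fin 5} (hij : i ≠ j) (hik : i ≠ k) (hjk : j ≠ k) :
    2 * (cellCount lab {i, j}ᶜ + cellCount lab {i, k}ᶜ + cellCount lab {j, k}ᶜ) =
      4 + fNumber C 4 := by
  classical
  have hS := hC.isSimplicialCellComplex
  obtain ⟨F, hF⟩ := hS.exists_dim_eq
  have hcard3 : ({i, j, k} : Finset (Fin 5)).card = 3 := Finset.card_eq_three.2
    ⟨i, j, k, hij, hik, hjk, rfl⟩
  have hcard2 : ({i, j, k} : Finset (Fin 5))ᶜ.card = 2 := by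
    rw [Finset.card_compl, hcard3, Fintype.card_fin]
  obtain ⟨e, heF, he⟩ := exists_le_vert_eq hS (lab := lab) (α := F) (S := {i, j, k}ᶜ)
    (Finset.card_pos.1 (by omega)) (by rw [vert_facet hS hF]; exact Finset.subset_univ _)
  have hdim : e.dim = 1 := by
    have := card_vert (lab := lab) hS e
    rw [he, hcard2] at this
    omega
  have hf : (cellsAbove e 4).card = fNumber C 4 := by
    refine (Nat.subtype_card _ fun α => ?_).symm
    rw [mem_cellsAbove]
    refine and_iff_right_of_imp fun hα => le_of_simple (lab := lab) hS hs hdim ?_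
    rw [vert_facet hS hα]
    exact Finset.subset_univ _
  have hfib : ∀ S : Finset (Fin 5), S.card = 3 → ({i, j, k} : Finset (Fin 5))ᶜ ⊆ S →
      ((cellsAbove e 2).filter fun τ => vert lab τ = S).card = cellCount lab S := by
    intro S hS3 hsub
    refine (Nat.subtype_card _ fun τ => ?_).symm
    rw [Finset.mem_filter, mem_cellsAbove]
    refine and_iff_right_of_imp fun hτ => ⟨le_of_simple (lab := lab) hS hs hdim ?_, ?_⟩
    · rw [he, hτ]; exact hsub
    · have := card_vert (lab := lab) hS τ
      rw [hτ, hS3] at this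
      omega
  have hpair : ∀ x y : Fin 5, x ≠ y → ({x, y}ᶜ : Finset (Fin 5)).card = 3 := fun x y hxy => by
    rw [Finset.card_compl, Finset.card_pair hxy, Fintype.card_fin]
  obtain ⟨n1, n2, n3⟩ := compl_pairs_ne hij hik hjk
  have h12 : ({i, j}ᶜ : Finset (Fin 5)) ∉
      ({{i, k}ᶜ, {j, k}ᶜ} : Finset (Finset (Fin 5))) := by
    rw [Finset.mem_insert, Finset.mem_singleton, not_or]
    exact ⟨n1, n2⟩
  have h3 : ({i, k}ᶜ : Finset (Fin 5)) ∉ ({{j, k}ᶜ} : Finset (Finset (Fin 5))) := by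
    rw [Finset.mem_singleton]
    exact n3
  have hT : (cellsAbove e 2).card =
      cellCount lab {i, j}ᶜ + cellCount lab {i, k}ᶜ + cellCount lab {j, k}ᶜ := by
    rw [Finset.card_eq_sum_card_fiberwise (f := vert lab)
      (t := {{i, j}ᶜ, {i, k}ᶜ, {j, k}ᶜ}) ?_]
    · rw [Finset.sum_insert h12, Finset.sum_insert h3,
        Finset.sum_singleton, hfib _ (hpair i j hij), hfib _ (hpair i k hik),
        hfib _ (hpair j k hjk), add_assoc]
      · exact Finset.compl_subset_compl.2 (by intro x; simp; tauto)
      · exact Finset.compl_subset_compl.2 (by intro x; simp; tauto)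
      · exact Finset.compl_subset_compl.2 (by intro x; simp; tauto)
    · intro τ hτ
      obtain ⟨h1, h2⟩ := mem_cellsAbove.1 hτ
      have h3 := card_vert (lab := lab) hS τ
      rw [h2] at h3
      have h4 := vert_mono (lab := lab) h1
      rw [he] at h4
      have := mem_pair_compl_of_card_three h3 h4
      simpa using this
  have h1 := euler_relation hC lab (ρ := e) (by omega)
  have h2 := two_mul_card_ridges hC lab hdim
  have h3 := card_cellsAbove_self e
  rw [hdim] at h3
  omega

end Counting

/-! ### The facets around a cell of codimension two -/

section Connectivity

open Classical in
theorem eq_zero_of_mem_line {P : Type*} {e τ : P} {x : P → ℝ}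
    (hx : x ∈ line[ℝ, (Pi.single e 1 : P → ℝ), Pi.single τ 1]) {σ : P} (he : σ ≠ e)
    (hτ : σ ≠ τ) : x σ = 0 := by
  have h := AffineSubspace.vsub_mem_direction hx
    (left_mem_affineSpan_pair ℝ (Pi.single e 1 : P → ℝ) (Pi.single τ 1))
  rw [direction_affineSpan, mem_vectorSpan_pair_rev] at h
  obtain ⟨r, hr⟩ := h
  have h' := congrFun hr σ
  simpa [he, hτ] using h'.symm

variable {P : Type*} [PartialOrder P] [Fintype P] {e τ : P}

open Classical in
/-- The midpoint of the segment between the vertices `e` and `τ` of the order complex, moved by `δ`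
towards the vertex `F`. -/
noncomputable def movedMidpoint (e τ F : P) (δ : ℝ) : P → ℝ :=
  (1 - δ) • ((1 / 2 : ℝ) • Pi.single e 1 + (1 / 2 : ℝ) • Pi.single τ 1) + δ • Pi.single F 1

theorem movedMidpoint_mem {F : P} (he : e < τ) (hF : τ ≤ F) {δ : ℝ} (h0 : 0 ≤ δ) (h1 : δ ≤ 1) :
    movedMidpoint e τ F δ ∈ orderComplexCarrier P := by
  classical
  refine ⟨fun σ => ?_, ?_, ?_⟩
  · simp only [movedMidpoint, Pi.add_apply, Pi.smul_apply, Pi.single_apply, smul_eq_mul]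
    have : 0 ≤ 1 - δ := by linarith
    split_ifs <;> positivity
  · rw [finsum_eq_sum_of_fintype]
    simp only [movedMidpoint, Pi.add_apply, Pi.smul_apply, smul_eq_mul, Finset.sum_add_distrib,
      ← Finset.mul_sum, Finset.sum_pi_single', Finset.mem_univ, if_true]
    ring
  · have hc : IsChain (· ≤ ·) ({e, τ, F} : Set P) := by
      refine IsChain.insert (IsChain.insert (by simp) fun b hb _ => Or.inl ?_) fun b hb _ =>
        Or.inl ?_
      · rw [Set.mem_singleton_iff.1 hb]; exact hF
      · rcases hb with rfl | hb
        · exact he.le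
        · rw [Set.mem_singleton_iff.1 hb]; exact he.le.trans hF
    refine hc.mono fun σ hσ => ?_
    by_contra hne
    simp only [Set.mem_insert_iff, Set.mem_singleton_iff, not_or] at hne
    refine hσ ?_
    simp [movedMidpoint, hne]

open Classical in
theorem exists_gt_of_notMem_line (he : e < τ)
    (hsat : ∀ σ, (σ ≤ e ∨ e ≤ σ) → (σ ≤ τ ∨ τ ≤ σ) → σ = e ∨ σ = τ ∨ τ < σ)
    {x : P → ℝ} (hx : x ∈ orderComplexCarrier P) (hxe : 0 < x e) (hxτ : 0 < x τ)
    (hline : x ∉ line[ℝ, (Pi.single e 1 : P → ℝ), Pi.single τ 1]) : ∃ σ, τ < σ ∧ 0 < x σ := by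
  obtain ⟨h0, h1, hc⟩ := hx
  by_contra! hle
  have hz : ∀ σ, σ ≠ e → σ ≠ τ → x σ = 0 := by
    intro σ hσe hστ
    by_contra hne
    rcases hsat σ (hc.total hne hxe.ne') (hc.total hne hxτ.ne') with h | h | h
    · exact hσe h
    · exact hστ h
    · exact hne (le_antisymm (hle σ h) (h0 σ))
  have hsum : x e + x τ = 1 := by
    rw [finsum_eq_sum_of_fintype,
      ← Finset.sum_subset (Finset.subset_univ {e, τ}) (fun σ _ hσ => ?_),
      Finset.sum_pair he.ne] at h1
    · exact h1
    · simp only [Finset.mem_insert, Finset.mem_singleton, not_or] at hσ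
      exact hz σ hσ.1 hσ.2
  refine hline ?_
  have hx' : x = AffineMap.lineMap (Pi.single e 1 : P → ℝ) (Pi.single τ 1) (x τ) := ?_
  · rw [hx']
    exact AffineMap.lineMap_mem_affineSpan_pair _ _ _
  ext σ
  by_cases hσe : σ = e
  · subst hσe
    simp [AffineMap.lineMap_apply, he.ne]
    linarith
  · by_cases hστ : σ = τ
    · subst hστ
      simp [AffineMap.lineMap_apply, he.ne']
    · simp [AffineMap.lineMap_apply, hσe, hστ, hz σ hσe hστ]

open Classical in
/-- Let `e < τ` be such that only elements above `τ` can be added to the chain `{e, τ}`, in a poset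
whose order complex is a PL sphere of dimension at least three. Near the midpoint of the segment
`eτ`, the complement of this segment is nonempty, and so are the elements above `τ`. Moreover, it is
connected, and so is the comparability graph on the elements above `τ`. -/
theorem exists_gt_and_connected {n : ℕ} (hn : 2 < n)
    (h : PLHomeomorphic (orderComplexCarrier P) (stdPLSphere (n + 1))) (he : e < τ)
    (hsat : ∀ σ, (σ ≤ e ∨ e ≤ σ) → (σ ≤ τ ∨ τ ≤ σ) → σ = e ∨ σ = τ ∨ τ < σ) :
    (∃ σ, τ < σ) ∧ ∀ Q : P → Prop, (∀ σ σ', τ < σ → σ ≤ σ' → (Q σ ↔ Q σ')) →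
      ∀ F F', τ < F → τ < F' → Q F → Q F' := by
  let t : P → ℝ := movedMidpoint e τ τ 0
  have hte : t e = 1 / 2 := by simp [t, movedMidpoint, he.ne]
  have htτ : t τ = 1 / 2 := by simp [t, movedMidpoint, he.ne']
  have htA : t ∈ orderComplexCarrier P := movedMidpoint_mem he le_rfl le_rfl zero_le_one
  have hW : IsOpen {x : P → ℝ | 0 < x e ∧ 0 < x τ} :=
    (isOpen_lt continuous_const (continuous_apply e)).inter
      (isOpen_lt continuous_const (continuous_apply τ))
  obtain ⟨N, hNsub, hN, hne, hpre⟩ := PLEuler.exists_nhdsWithin_diff_line_isPreconnected hn h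
    (Pi.single e 1) (Pi.single τ 1) htA hW ⟨by rw [hte]; norm_num, by rw [htτ]; norm_num⟩
  have hgt : ∀ x ∈ N \ line[ℝ, (Pi.single e 1 : P → ℝ), Pi.single τ 1],
      ∃ σ, τ < σ ∧ 0 < x σ := fun x hx =>
    exists_gt_of_notMem_line he hsat (hNsub hx.1).1 (hNsub hx.1).2.1 (hNsub hx.1).2.2 hx.2
  constructor
  · obtain ⟨x, hx⟩ := hne
    obtain ⟨σ, hσ, -⟩ := hgt x hx
    exact ⟨σ, hσ⟩
  intro Q hQ F F' hF hF' hQF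
  by_contra hQF'
  -- the neighbourhood contains points with positive coordinate at any given element above `τ`
  have hnear : ∀ G, τ < G → ∃ x ∈ N \ line[ℝ, (Pi.single e 1 : P → ℝ), Pi.single τ 1],
      0 < x G := by
    intro G hG
    have hcont : Continuous (movedMidpoint e τ G) := by
      unfold movedMidpoint
      fun_prop
    have h0 : movedMidpoint e τ G 0 = t := by simp [movedMidpoint, t]
    have htend : Filter.Tendsto (movedMidpoint e τ G) (𝓝[>] 0) (𝓝[orderComplexCarrier P] t) := by
      refine tendsto_nhdsWithin_iff.2 ⟨?_, ?_⟩
      · rw [← h0]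
        exact (hcont.tendsto 0).mono_left nhdsWithin_le_nhds
      · filter_upwards [Ioo_mem_nhdsGT (zero_lt_one' ℝ)] with δ hδ
        exact movedMidpoint_mem he hG.le hδ.1.le hδ.2.le
    obtain ⟨δ, hδN, hδ⟩ := ((htend.eventually_mem hN).and self_mem_nhdsWithin).exists
    have hpos : 0 < movedMidpoint e τ G δ G := by
      have : movedMidpoint e τ G δ G = δ := by
        simp [movedMidpoint, hG.ne',
          (he.trans hG).ne']
      rw [this]; exact hδ
    refine ⟨_, ⟨hδN, fun hl => ?_⟩, hpos⟩
    exact hpos.ne' (eq_zero_of_mem_line hl (he.trans hG).ne' hG.ne')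
  have hopen : ∀ R : P → Prop, IsOpen {x : P → ℝ | ∃ σ, (τ < σ ∧ R σ) ∧ 0 < x σ} := by
    intro R
    have : {x : P → ℝ | ∃ σ, (τ < σ ∧ R σ) ∧ 0 < x σ} =
        ⋃ σ, ⋃ _ : τ < σ ∧ R σ, {x : P → ℝ | 0 < x σ} := by
      ext x; simp
    rw [this]
    exact isOpen_iUnion fun σ => isOpen_iUnion fun _ =>
      isOpen_lt continuous_const (continuous_apply σ)
  obtain ⟨x, hxN, ⟨σ, ⟨hσ, hQσ⟩, hxσ⟩, σ', ⟨hσ', hQσ'⟩, hxσ'⟩ := hpre _ _ (hopen Q)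
    (hopen fun σ => ¬ Q σ) (fun x hx => by
      obtain ⟨σ, hσ, hxσ⟩ := hgt x hx
      by_cases hq : Q σ
      · exact Or.inl ⟨σ, ⟨hσ, hq⟩, hxσ⟩
      · exact Or.inr ⟨σ, ⟨hσ, hq⟩, hxσ⟩)
    (by
      obtain ⟨x, hx, hxF⟩ := hnear F hF
      exact ⟨x, hx, F, ⟨hF, hQF⟩, hxF⟩)
    (by
      obtain ⟨x, hx, hxF⟩ := hnear F' hF'
      exact ⟨x, hx, F', ⟨hF', hQF'⟩, hxF⟩)
  rcases (hNsub hxN.1).1.2.2.total hxσ.ne' hxσ'.ne' with hle | hle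
  · exact hQσ' ((hQ σ σ' hσ hle).1 hQσ)
  · exact hQσ' ((hQ σ' σ hσ' hle).2 hQσ)

variable {X : Type u} [TopologicalSpace X] {C : Set X} [CWComplex C]

/-- In a pseudotriangulated closed `4`-manifold, there is a facet above each `2`-cell `τ`, and a set
of facets above `τ` that is closed under adjacency along `3`-cells above `τ` is empty or contains
all of them. -/
theorem facets_above_triangle (hC : IsPseudotriangulation C 4) (lab : Fin 5 ≃ Vertex C)
    {τ : Face C} (hτ : τ.dim = 2) :
    (∃ F, F.dim = 4 ∧ τ ≤ F) ∧ ∀ S : Set (Face C),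
      (∀ F F' ρ : Face C, F.dim = 4 → F'.dim = 4 → ρ.dim = 3 → τ ≤ ρ → ρ ≤ F → ρ ≤ F' →
        F ∈ S → F' ∈ S) →
      ∀ F F' : Face C, F.dim = 4 → F'.dim = 4 → τ ≤ F → τ ≤ F' → F ∈ S → F' ∈ S := by
  classical
  have hS := hC.isSimplicialCellComplex
  have := hS.finite
  have := Fintype.ofFinite (Face C)
  obtain ⟨i, hi⟩ : (vert lab τ).Nonempty := Finset.card_pos.1 (by rw [card_vert hS]; omega)
  set v := lab i
  have hv : v.1 < τ := lt_of_le_of_ne (mem_vert.1 hi) fun h => by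
    have := v.2
    rw [h] at this
    omega
  obtain ⟨j, hj, hji⟩ := Finset.exists_mem_ne
    (show 1 < (vert lab τ).card by rw [card_vert hS]; omega) i
  obtain ⟨e, heτ, he⟩ := exists_le_vert_eq hS (α := τ) (S := {i, j}) ⟨i, by simp⟩ (by
    intro k hk
    rcases Finset.mem_insert.1 hk with rfl | hk
    · exact hi
    · rw [Finset.mem_singleton.1 hk]; exact hj)
  have hedim : e.dim = 1 := by
    have := card_vert (lab := lab) hS e
    rw [he, Finset.card_pair hji.symm] at this
    omega
  have hve : v.1 < e := lt_of_le_of_ne (mem_vert.1 (by rw [he]; simp)) fun h => by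
    have := v.2
    rw [h] at this
    omega
  have heτ' : e < τ := lt_of_le_of_ne heτ fun h => by rw [h] at hedim; omega
  let τ' : {α : Face C // v.1 < α} := ⟨τ, hv⟩
  let e' : {α : Face C // v.1 < α} := ⟨e, hve⟩
  have hpos : ∀ σ : {α : Face C // v.1 < α}, 0 < σ.1.dim := fun σ =>
    (Nat.zero_le _).trans_lt (Face.dim_lt_dim σ.2)
  have hsat : ∀ σ : {α : Face C // v.1 < α}, (σ ≤ e' ∨ e' ≤ σ) → (σ ≤ τ' ∨ τ' ≤ σ) →
      σ = e' ∨ σ = τ' ∨ τ' < σ := by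
    intro σ h1 h2
    rcases h2 with h2 | h2
    · rcases h2.eq_or_lt with h2 | h2
      · exact Or.inr (Or.inl h2)
      left
      have hd := Face.dim_lt_dim (show σ.1 < τ from h2)
      have hp := hpos σ
      rcases h1 with h1 | h1
      · rcases Face.eq_or_dim_lt (show σ.1 ≤ e from h1) with h | h
        · exact Subtype.ext h
        · omega
      · rcases Face.eq_or_dim_lt (show e ≤ σ.1 from h1) with h | h
        · exact Subtype.ext h.symm
        · omega
    · rcases h2.eq_or_lt with h2 | h2
      · exact Or.inr (Or.inl h2.symm)
      · exact Or.inr (Or.inr h2)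
  obtain ⟨⟨σ, hσ⟩, hconn⟩ := exists_gt_and_connected (n := 3) (by norm_num) (hC.vertexFigure v)
    (show e' < τ' from heτ') hsat
  have hdim : ∀ σ : {α : Face C // v.1 < α}, τ' < σ → σ.1.dim = 3 ∨ σ.1.dim = 4 := by
    intro σ hσ
    have h1 := Face.dim_lt_dim (show τ < σ.1 from hσ)
    have h2 := hS.dim_le σ.1
    omega
  constructor
  · rcases hdim σ hσ with h | h
    · have hcard := card_facets_above_ridge hC lab h
      obtain ⟨F, hF⟩ := Finset.card_pos.1 (show 0 < (cellsAbove σ.1 4).card by omega)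
      obtain ⟨h1, h2⟩ := mem_cellsAbove.1 hF
      exact ⟨F, h2, (show τ < σ.1 from hσ).le.trans h1⟩
    · exact ⟨σ.1, h, (show τ < σ.1 from hσ).le⟩
  · intro S hadj F F' hF hF' hτF hτF' hFS
    have hlt : ∀ G : Face C, G.dim = 4 → τ ≤ G → τ < G := fun G hG h =>
      lt_of_le_of_ne h fun h' => by rw [h'] at hτ; omega
    have hfacet : ∀ G G' : Face C, G.dim = 4 → G ≤ G' → G = G' := fun G G' hG h =>
      (Face.eq_or_dim_lt h).resolve_right fun h' => by
        have := hS.dim_le G'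
        omega
    have key := hconn (fun σ => ∃ G ∈ S, G.dim = 4 ∧ σ.1 ≤ G) ?_ ⟨F, hv.trans (hlt F hF hτF)⟩
      ⟨F', hv.trans (hlt F' hF' hτF')⟩ (hlt F hF hτF) (hlt F' hF' hτF') ⟨F, hFS, hF, le_rfl⟩
    · obtain ⟨G, hGS, hG, hle⟩ := key
      rw [hfacet F' G hF' hle]
      exact hGS
    · intro σ σ' hσ hle
      constructor
      · rintro ⟨G, hGS, hG, hσG⟩
        rcases hdim σ hσ with h | h
        · rcases hdim σ' (hσ.trans_le hle) with h' | h'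
          · have : σ.1 = σ'.1 := (Face.eq_or_dim_lt hle).resolve_right (by omega)
            exact ⟨G, hGS, hG, this ▸ hσG⟩
          · exact ⟨σ'.1, hadj G σ'.1 σ.1 hG h' h (show τ < σ.1 from hσ).le hσG hle hGS, h', le_rfl⟩
        · rw [← hfacet σ.1 σ'.1 h hle]
          exact ⟨G, hGS, hG, hσG⟩
      · rintro ⟨G, hGS, hG, hσG⟩
        exact ⟨G, hGS, hG, le_trans hle hσG⟩

end Connectivity

/-! ### Bicoloured components of the dual graph -/

section Components

variable {X : Type u} [TopologicalSpace X] {C : Set X} [CWComplex C]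

/-- A `3`-cell misses exactly one vertex. -/
theorem vert_eq_compl_singleton (hC : IsSimplicialCellComplex C 4) {lab : Fin 5 ≃ Vertex C}
    {ρ : Face C} (hρ : ρ.dim = 3) {c : Fin 5} (hc : ¬ (lab c).1 ≤ ρ) :
    vert lab ρ = {c}ᶜ := by
  apply Finset.eq_of_subset_of_card_le
  · intro i hi
    rw [Finset.mem_compl, Finset.mem_singleton]
    rintro rfl
    exact hc (mem_vert.1 hi)
  · rw [card_vert hC, hρ, Finset.card_compl, Finset.card_singleton, Fintype.card_fin]

/-- The components of the subgraph with the colours `i` and `j` correspond to the `2`-cells whose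
vertices have the other three labels: a facet contains exactly one such cell, adjacent facets
contain the same one, and the facets around a `2`-cell are connected to each other through
`3`-cells containing it. -/
theorem numComponents_colorSubgraph (hC : IsPseudotriangulation C 4) (lab : Fin 5 ≃ Vertex C)
    {i j : Fin 5} (hij : i ≠ j) :
    numComponents (colorSubgraph (d := 4) lab {i, j}) = cellCount lab {i, j}ᶜ := by
  have hS := hC.isSimplicialCellComplex
  have hcard : ({i, j}ᶜ : Finset (Fin 5)).card = 3 := by
    rw [Finset.card_compl, Finset.card_pair hij, Fintype.card_fin]
  have hex : ∀ F : {z // z ∈ (colorSubgraph (d := 4) lab {i, j}).vertexSet},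
      ∃ τ ≤ F.1, vert lab τ = {i, j}ᶜ := fun F => by
    have hF : F.1.dim = 4 := F.2
    exact exists_le_vert_eq hS (Finset.card_pos.1 (by omega))
      (by rw [vert_facet hS hF]; exact Finset.subset_univ _)
  choose face hface hvert using hex
  have hdim : ∀ τ : Face C, vert lab τ = {i, j}ᶜ → τ.dim = 2 := fun τ hτ => by
    have := card_vert (lab := lab) hS τ
    rw [hτ, hcard] at this
    omega
  have hrel : ∀ F F' : {z // z ∈ (colorSubgraph (d := 4) lab {i, j}).vertexSet},
      (colorSubgraph (d := 4) lab {i, j}).Adj F.1 F'.1 → face F = face F' := by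
    rintro F F' ⟨⟨p, ρ⟩, ⟨c, hc, hcol⟩, -, -, -, -, hρ, hρF, hρF'⟩
    have hρ3 : ρ.dim = 3 := by simpa using hρ
    have hvρ := vert_eq_compl_singleton hS hρ3 hcol
    have hci : c = i ∨ c = j := hc
    obtain ⟨τ, hτρ, hτ⟩ := exists_le_vert_eq hS (lab := lab) (α := ρ) (S := {i, j}ᶜ)
      (Finset.card_pos.1 (by omega)) (by
        rw [hvρ, Finset.compl_subset_compl, Finset.singleton_subset_iff]
        simpa using hci)
    rw [eq_of_vert_eq (lab := lab) hS (hface F) (hτρ.trans hρF) ((hvert F).trans hτ.symm),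
      eq_of_vert_eq (lab := lab) hS (hface F') (hτρ.trans hρF') ((hvert F').trans hτ.symm)]
  refine Nat.card_eq_of_bijective (fun q => (⟨Quot.lift face hrel q, by
    induction q using Quot.ind with
    | _ F => exact hvert F⟩ : {τ : Face C // vert lab τ = {i, j}ᶜ})) ⟨?_, ?_⟩
  · intro q q' hqq
    induction q using Quot.ind with | _ F => ?_
    induction q' using Quot.ind with | _ F' => ?_
    have hff : face F = face F' := congrArg Subtype.val hqq
    obtain ⟨-, hconn⟩ := facets_above_triangle hC lab (hdim _ (hvert F))
    have key := hconn {G | ∃ hG : G ∈ (colorSubgraph (d := 4) lab {i, j}).vertexSet,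
      Quot.mk (fun x y : {z // z ∈ (colorSubgraph (d := 4) lab {i, j}).vertexSet} =>
        (colorSubgraph (d := 4) lab {i, j}).Adj x.1 y.1) ⟨G, hG⟩ = Quot.mk _ F} ?_ F.1 F'.1
      F.2 F'.2 (hface F) (hff ▸ hface F') ⟨F.2, rfl⟩
    · obtain ⟨_, h⟩ := key
      exact h.symm
    · rintro G G' ρ hG hG' hρ hτρ hρG hρG' ⟨hGV, hGF⟩
      refine ⟨hG', ?_⟩
      by_cases hne : G' = G
      · subst hne; exact hGF
      rw [← hGF]
      apply Quot.sound
      have hlt : (vert lab ρ).card < (Finset.univ : Finset (Fin 5)).card := by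
        rw [card_vert hS, hρ, Finset.card_univ, Fintype.card_fin]; norm_num
      obtain ⟨c, -, hc⟩ := Finset.exists_mem_notMem_of_card_lt_card hlt
      have hcij : c = i ∨ c = j := by
        by_contra hcon
        refine hc (vert_mono hτρ ?_)
        rw [hvert, Finset.mem_compl]
        simpa using hcon
      exact ⟨(s(G', G), ρ), ⟨c, hcij, fun h => hc (mem_vert.2 h)⟩, rfl, hne, hG', hG,
        by rw [hρ], hρG', hρG⟩
  · rintro ⟨τ, hτ⟩
    obtain ⟨⟨F, hF, hτF⟩, -⟩ := facets_above_triangle hC lab (hdim _ hτ)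
    refine ⟨Quot.mk _ ⟨F, hF⟩, Subtype.ext ?_⟩
    exact eq_of_vert_eq (lab := lab) hS (hface ⟨F, hF⟩) hτF ((hvert _).trans hτ.symm)

end Components

/-! ### Solving the linear equations -/

/-- A symmetric function on the pairs from a set with five elements, whose sum over the pairs in
any set of three elements is the same, is constant. -/
theorem pairs_eq_of_sum_eq {g : Fin 5 → Fin 5 → ℕ} {s : ℕ} (hsymm : ∀ i j, g i j = g j i)
    (hsum : ∀ i j k, i ≠ j → i ≠ k → j ≠ k → 2 * (g i j + g i k + g j k) = s) :
    ∀ i j, i ≠ j → g i j = g 0 1 := by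
  have disj : ∀ i j k l : Fin 5, i ≠ j → i ≠ k → i ≠ l → j ≠ k → j ≠ l → k ≠ l →
      g i j = g k l := by
    intro i j k l hij hik hil hjk hjl hkl
    have h1 := hsum i j k hij hik hjk
    have h2 := hsum i j l hij hil hjl
    have h3 := hsum i k l hik hil hkl
    have h4 := hsum j k l hjk hjl hkl
    omega
  -- two pairs that meet are both disjoint from a third one
  have adj : ∀ i j k : Fin 5, i ≠ j → i ≠ k → j ≠ k → g i j = g i k := by
    intro i j k hij hik hjk
    obtain ⟨l, m, hl⟩ : ∃ l m : Fin 5, l ≠ m ∧ l ≠ i ∧ l ≠ j ∧ l ≠ k ∧ m ≠ i ∧ m ≠ j ∧ m ≠ k := by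
      revert i j k
      decide
    rw [disj i j l m hij hl.2.1.symm hl.2.2.2.2.1.symm hl.2.2.1.symm hl.2.2.2.2.2.1.symm hl.1,
      disj i k l m hik hl.2.1.symm hl.2.2.2.2.1.symm hl.2.2.2.1.symm hl.2.2.2.2.2.2.symm hl.1]
  intro i j hij
  by_cases h0i : i = 0
  · subst h0i
    by_cases h1 : j = 1
    · rw [h1]
    · exact adj 0 j 1 hij (by decide) h1
  by_cases h0j : j = 0
  · subst h0j
    rw [hsymm]
    by_cases h1 : i = 1
    · rw [h1]
    · exact adj 0 i 1 hij.symm (by decide) h1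
  by_cases h1i : i = 1
  · subst h1i
    rw [hsymm 0 1]
    exact adj 1 j 0 hij (by decide) h0j
  rw [adj i j 0 hij h0i h0j, hsymm i 0]
  exact adj 0 i 1 (Ne.symm h0i) (by decide) h1i

end CellCx

theorem mainTheorem5 {X : Type*} [TopologicalSpace X] [T2Space X] (M : Set X)
    [Topology.CWComplex M]
    (hM : CellCx.IsPseudotriangulation M 4)
    (hcontr : CellCx.IsContracted M 4)
    (hsimple : CellCx.IsSimple M)
    (lab : Fin (4 + 1) ≃ CellCx.Vertex M) :
    ∃ m : ℕ,
      (∀ i j : Fin (4 + 1), i ≠ j →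
        CellCx.numComponents (CellCx.colorSubgraph lab {i, j}) = m) ∧
      (CellCx.fNumber M 4 : ℤ) = 6 * (m : ℤ) - 4 := by
  have := hM.isSimplicialCellComplex.finite
  have := Fintype.ofFinite (CellCx.Face M)
  have hsum : ∀ i j k : Fin 5, i ≠ j → i ≠ k → j ≠ k →
      2 * (CellCx.cellCount lab {i, j}ᶜ + CellCx.cellCount lab {i, k}ᶜ +
        CellCx.cellCount lab {j, k}ᶜ) = 4 + CellCx.fNumber M 4 := fun i j k hij hik hjk =>
    CellCx.two_mul_sum_cellCount hM hsimple lab hij hik hjk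
  have hconst := CellCx.pairs_eq_of_sum_eq (g := fun i j => CellCx.cellCount lab {i, j}ᶜ)
    (fun i j => by simp only [Finset.pair_comm]) hsum
  refine ⟨CellCx.cellCount lab {0, 1}ᶜ, fun i j hij => ?_, ?_⟩
  · rw [CellCx.numComponents_colorSubgraph hM lab hij]
    exact hconst i j hij
  · have h := hsum 0 1 2 (by decide) (by decide) (by decide)
    have h02 := hconst 0 2 (by decide)
    have h12 := hconst 1 2 (by decide)
    rw [h02, h12] at h
    omega
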